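/- Write $\widehat{\mathbb C}=\mathbb C\cup\{\infty\}$ and $\exp_1(z)=e^{2\pi i z}$. Let $f:\mathbb C\to\widehat{\mathbb C}$ be a transcendental meromorphic function that is projectable via $\exp_1$, i.e. there is a function $g$ with $g\circ\exp_1=\exp_1\circ f$ wherever $f$ is finite, and let $\ell\in\mathbb Z$ be such that $f(z+1)=f(z)+\ell$ for all $z$ (with $\infty+\ell=\infty$). The Fatou set $\mathcal F(f)$ is the largest open subset of $\mathbb C$ on which all iterates $f^n$ are defined and form a normal family (with respect to the spherical metric), and a Fatou component is a connected component of $\mathcal F(f)$. Let $p\ge 1$ and $\sigma\in\mathbb Z\setminus\{0\}$, and let $z^*\in\mathbb C$ with $f(z^*)\neq\infty$ be a $(p,\sigma)$-pseudoperiodic point of $f$, i.e. $f^p(z^*)=z^*+\sigma$ and there are no $1\le q<p$ and $\tau\in\mathbb Z$ with $f^q(z^*)=z^*+\tau$. Suppose that $z^*$ lies in a Fatou component $U$ of $f$. For $A\subset\mathbb C$, let $\operatorname{fill}(A)$ be the union of $A$ and all bounded connected components of $\mathbb C\setminus A$. If $0\notin\operatorname{fill}(\exp_1 U)$ and either $|\ell|\ge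 2$ or $\ell^p=1$, then $U$ is an escaping wandering domain; that is, the Fatou components $U_n\supset f^n(U)$, $n\ge 0$, satisfy $U_n\ne U_m$ for all $n\neq m$, and the constant $\infty$ is the only limit function of $\{f^n|_U\}_{n\in\mathbb N}$, where a limit function is a locally uniform limit on $U$ (in the spherical metric) of a subsequence $f^{n_k}|_U$ with $n_k$ strictly increasing. -/

import Mathlib

open scoped Topology

noncomputable section

/-- The exponential of period one, `exp₁ z = e^{2πiz}`. -/
def expOne (z : ℂ) : ℂ := Complex.exp (2 * Real.pi * Complex.I * z)

/-- `f : ℂ → Ĉ` is a meromorphic function: off its poles it is an analytic function, and it takes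
the value `∞` exactly at its poles. (A function in meromorphic normal form fails to be analytic
exactly at its poles.) -/
def IsMeromorphicMap (f : ℂ → OnePoint ℂ) : Prop :=
  ∃ F : ℂ → ℂ, MeromorphicNFOn F Set.univ ∧
    (∀ z, AnalyticAt ℂ F z → f z = (F z : OnePoint ℂ)) ∧
    (∀ z, ¬ AnalyticAt ℂ F z → f z = OnePoint.infty)

/-- `f` agrees with a quotient of two polynomials (off the zeros of the denominator). -/
def IsRationalMap (f : ℂ → OnePoint ℂ) : Prop :=
  ∃ P Q : Polynomial ℂ, Q ≠ 0 ∧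
    ∀ z, Q.eval z ≠ 0 → f z = ((P.eval z / Q.eval z : ℂ) : OnePoint ℂ)

/-- A transcendental meromorphic function `ℂ → Ĉ`. -/
def IsTranscendentalMeromorphic (f : ℂ → OnePoint ℂ) : Prop :=
  IsMeromorphicMap f ∧ ¬ IsRationalMap f

/-- `f` is projectable via `exp₁`: it is transcendental meromorphic, and `g ∘ exp₁ = exp₁ ∘ f` for
some `g`, wherever `f` is finite (only the values of `g` at such points `exp₁ z` matter). -/
def IsProjectable (f : ℂ → OnePoint ℂ) : Prop :=
  IsTranscendentalMeromorphic f ∧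
    ∃ g : ℂ → ℂ, ∀ z w : ℂ, f z = (w : OnePoint ℂ) → g (expOne z) = expOne w

/-- `f (z + 1) = f z + ℓ` for all `z`, where `∞ + ℓ = ∞`. -/
def HasPseudoperiod (f : ℂ → OnePoint ℂ) (l : ℤ) : Prop :=
  ∀ z : ℂ, f (z + 1) = OnePoint.map (fun w : ℂ => w + (l : ℂ)) (f z)

/-- The `n`-th iterate of `f : ℂ → Ĉ`. Since `f` is not defined at `∞`, this is meaningful only
where `IterDefined f n z` holds; elsewhere it has the junk value `∞`. -/
def iter (f : ℂ → OnePoint ℂ) : ℕ → ℂ → OnePoint ℂ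
  | 0, z => (z : OnePoint ℂ)
  | n + 1, z => (iter f n z).elim OnePoint.infty f

/-- The `n`-th iterate of `f` is defined at `z`: no earlier iterate of `z` is `∞`. -/
def IterDefined (f : ℂ → OnePoint ℂ) (n : ℕ) (z : ℂ) : Prop :=
  ∀ m < n, iter f m z ≠ OnePoint.infty

/-- Locally uniform convergence on `W` of maps into the Riemann sphere, with respect to the unique
uniform structure of the compact Hausdorff space `Ĉ` (that of the spherical metric). -/
def SphereTendsto (φ : ℕ → ℂ → OnePoint ℂ) (h : ℂ → OnePoint ℂ) (W : Set ℂ) : Prop :=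
  letI : UniformSpace (OnePoint ℂ) := uniformSpaceOfCompactR1
  TendstoLocallyUniformlyOn φ h Filter.atTop W

/-- The family of iterates of `f` is defined and normal on `W`: every sequence of iterates has a
subsequence converging locally uniformly on `W` to a map into `Ĉ`. -/
def IteratesNormalOn (f : ℂ → OnePoint ℂ) (W : Set ℂ) : Prop :=
  (∀ n, ∀ z ∈ W, IterDefined f n z) ∧
    ∀ s : ℕ → ℕ, ∃ t : ℕ → ℕ, StrictMono t ∧
      ∃ h : ℂ → OnePoint ℂ, SphereTendsto (fun k => iter f (s (t k))) h W

/-- The Fatou set: the union of the open sets on which the iterates are defined and normal.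
(The point `∞`, where a transcendental `f` is not defined, never belongs to it.) -/
def fatouSet (f : ℂ → OnePoint ℂ) : Set ℂ :=
  ⋃₀ {W : Set ℂ | IsOpen W ∧ IteratesNormalOn f W}

/-- A connected component of the Fatou set. -/
def IsFatouComponent (f : ℂ → OnePoint ℂ) (U : Set ℂ) : Prop :=
  ∃ z ∈ fatouSet f, U = connectedComponentIn (fatouSet f) z

/-- `U` is a wandering domain: it is a Fatou component, and the Fatou components `V n` that contain
the sets `fⁿ(U)` are pairwise distinct. -/
def IsWanderingDomain (f : ℂ → OnePoint ℂ) (U : Set ℂ) : Prop :=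
  IsFatouComponent f U ∧
    ∃ V : ℕ → Set ℂ,
      (∀ n, IsFatouComponent f (V n) ∧ iter f n '' U ⊆ ((↑) : ℂ → OnePoint ℂ) '' V n) ∧
      ∀ n m, n ≠ m → V n ≠ V m

/-- `h` is (on `U`) a limit function of the sequence of iterates of `f` restricted to `U`. -/
def IsLimitFunction (f : ℂ → OnePoint ℂ) (U : Set ℂ) (h : ℂ → OnePoint ℂ) : Prop :=
  ∃ s : ℕ → ℕ, StrictMono s ∧ SphereTendsto (fun k => iter f (s k)) h U

/-- `U` is an escaping wandering domain: a wandering domain on which the constant `∞` is the only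
limit function of the iterates. -/
def IsEscapingWanderingDomain (f : ℂ → OnePoint ℂ) (U : Set ℂ) : Prop :=
  IsWanderingDomain f U ∧
    ∀ h : ℂ → OnePoint ℂ, IsLimitFunction f U h ↔ ∀ z ∈ U, h z = OnePoint.infty

/-- The fill of a plane set: its union with the bounded components of its complement. -/
def fill (A : Set ℂ) : Set ℂ :=
  A ∪ {w : ℂ | w ∈ Aᶜ ∧ Bornology.IsBounded (connectedComponentIn Aᶜ w)}

/-- `z` is a pseudoperiodic point of `f` of type `(p, σ)`. -/
def IsPseudoperiodicOfType (f : ℂ → OnePoint ℂ) (p : ℕ) (σ : ℤ) (z : ℂ) : Prop :=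
  1 ≤ p ∧ f z ≠ OnePoint.infty ∧ iter f p z = ((z + (σ : ℂ) : ℂ) : OnePoint ℂ)

/-- `z` is `(p, σ)`-pseudoperiodic, i.e. pseudoperiodic of minimal type `(p, σ)`: in addition, `z`
is not pseudoperiodic of type `(q, τ)` for any `q < p` and any integer `τ`. -/
def IsPseudoperiodic (f : ℂ → OnePoint ℂ) (p : ℕ) (σ : ℤ) (z : ℂ) : Prop :=
  IsPseudoperiodicOfType f p σ z ∧
    ∀ (q : ℕ) (τ : ℤ), IsPseudoperiodicOfType f q τ z → p ≤ q

end

/-!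
Let `F` be the complex-valued function representing `f`. On the Fatou set the iterates of `f` are
the iterates of `F`. Iterating the pseudoperiod gives `fⁿ(w + k) = fⁿ(w) + k ℓⁿ`, hence
`f^{pn}(z) = z + σ (1 + ℓᵖ + ⋯ + ℓ^{p(n-1)})`, and either assumption on `ℓ` makes the orbit of `z`
escape. Harnack's inequality for `log ‖fⁿ‖` (`log_norm_le_three_mul`) spreads this over the
component `U`, where `fⁿ → ∞` locally uniformly (`Represents.tendsto_norm_iterate_atTop`); so `∞`
is the only limit function.

It remains to show that the components along the orbit are distinct. If two of them coincide, then
some Fatou component `V` contains a point `z'` of the orbit of `z` under `fᵖ` together with `z' + q`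
for a nonzero integer `q`.

* If `ℓᵖ = 1`, then `ℓ = ±1` and the Fatou set is invariant under integer translations
  (`Represents.add_int_mem_fatouSet`). Thus `U` contains `z` and `z + q`. A path joining them in `U`
  is mapped by `exp₁` to a closed curve winding `q` times around `0`, so `0 ∈ fill (exp₁ U)`
  (`zero_mem_fill_of_add_int_mem`), contrary to the hypothesis.
* If `|ℓ| ≥ 2`, such a `V` does not exist at all (`Represents.add_int_notMem_component`). The tool
  is `Represents.isRationalMap_of_growth`: a transcendental `f` with a pseudoperiod cannot be
  finite and of polynomial growth on arbitrarily large discs centred at integers of comparable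
  size, because the discs can be translated to the origin. On the other hand `f^{m+1}` is bounded
  by a fixed power of `f^m` locally in `V`, again by Harnack's inequality. If the logarithmic
  derivatives of the `fᵐ` were not locally bounded, Bloch's theorem applied to `log fᵐ` would make
  `fᵐ` cover large round annuli, and these contain forbidden discs. So the functions `f^{pn} /
  f^{pn}(z')` are locally bounded in `V` and have a limit `G`, with `G(z') = 1` and `G(z' + q) ≠
  1`. Since `G` is open at `z'`, the images `f^{pn}(V)` contain discs around `f^{pn}(z') ∈ z' + ℤ`
  of radius proportional to `‖f^{pn}(z')‖`: forbidden discs again.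
-/

open Filter Metric Set

/-! ### Holomorphic functions on discs -/

/-- A nonvanishing holomorphic function on a disc has a holomorphic logarithm. -/
theorem exists_log_on_ball {h : ℂ → ℂ} {c : ℂ} {r : ℝ} (hd : DifferentiableOn ℂ h (ball c r))
    (h0 : ∀ z ∈ ball c r, h z ≠ 0) :
    ∃ v : ℂ → ℂ, (∀ z ∈ ball c r, HasDerivAt v (deriv h z / h z) z) ∧
      ∀ z ∈ ball c r, Complex.exp (v z) = h z := by
  rcases le_or_gt r 0 with hr | hr
  · exact ⟨0, by simp [ball_eq_empty.2 hr]⟩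
  have hc : c ∈ ball c r := mem_ball_self hr
  have hd' : DifferentiableOn ℂ (fun z => deriv h z / h z) (ball c r) :=
    (hd.deriv isOpen_ball).div hd h0
  obtain ⟨v, hvc, hv⟩ := (hd'.isExactOn_ball).with_val_at c (Complex.log (h c))
  refine ⟨v, hv, ?_⟩
  have key : ∀ z ∈ ball c r, HasDerivAt (fun z => Complex.exp (v z) / h z) 0 z := by
    intro z hz
    have h1 := ((hv z hz).cexp).div
      ((hd.differentiableAt (isOpen_ball.mem_nhds hz)).hasDerivAt) (h0 z hz)
    rwa [mul_assoc, div_mul_cancel₀ _ (h0 z hz), sub_self, zero_div] at h1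
  intro z hz
  have hconst := isOpen_ball.is_const_of_deriv_eq_zero (convex_ball c r).isPreconnected
    (fun z hz => (key z hz).differentiableAt.differentiableWithinAt)
    (fun z hz => (key z hz).deriv) hz hc
  have h2 := h0 c hc
  simp only [hvc, Complex.exp_log h2, div_self h2] at hconst
  exact (div_eq_one_iff_eq (h0 z hz)).1 hconst

/-- A holomorphic map of a disc into the right half-plane at most triples its real part when
passing from the centre to a point of the half-disc: the Schwarz lemma after a Cayley transform. -/
theorem re_le_three_mul_re_center {v : ℂ → ℂ} {c z : ℂ} {r : ℝ}
    (hd : DifferentiableOn ℂ v (ball c r)) (hv : ∀ z ∈ ball c r, 0 < (v z).re)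
    (hz : z ∈ ball c (r / 2)) : (v z).re ≤ 3 * (v c).re ∧ (v c).re ≤ 3 * (v z).re := by
  have hr : 0 < r := by linarith [dist_nonneg.trans_lt (mem_ball.1 hz)]
  have hc : c ∈ ball c r := mem_ball_self hr
  have hzr : z ∈ ball c r := ball_subset_ball (by linarith) hz
  set a := v c with ha
  have hden : ∀ w ∈ ball c r, v w + (starRingEnd ℂ) a ≠ 0 := by
    intro w hw h0
    have := congrArg Complex.re h0
    simp at this
    linarith [hv w hw, hv c hc]
  have key : ∀ w : ℂ, ‖w - a‖ ^ 2 = (w.re - a.re) ^ 2 + (w.im - a.im) ^ 2 ∧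
      ‖w + (starRingEnd ℂ) a‖ ^ 2 = (w.re + a.re) ^ 2 + (w.im - a.im) ^ 2 := by
    intro w
    simp only [Complex.sq_norm, Complex.normSq_apply, Complex.sub_re, Complex.sub_im,
      Complex.add_re, Complex.add_im, Complex.conj_re, Complex.conj_im]
    constructor <;> ring
  have hψ : DifferentiableOn ℂ (fun w => (v w - a) / (v w + (starRingEnd ℂ) a)) (ball c r) :=
    (hd.sub_const _).div (hd.add_const _) hden
  have hle : ∀ w ∈ ball c r, ‖v w - a‖ ≤ ‖v w + (starRingEnd ℂ) a‖ := by
    intro w hw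
    have h1 := hv w hw
    have h2 := hv c hc
    obtain ⟨k1, k2⟩ := key (v w)
    refine (sq_le_sq₀ (norm_nonneg _) (norm_nonneg _)).1 ?_
    rw [k1, k2]
    nlinarith
  have hmaps : MapsTo (fun w => (v w - a) / (v w + (starRingEnd ℂ) a)) (ball c r)
      (closedBall ((fun w => (v w - a) / (v w + (starRingEnd ℂ) a)) c) 1) := by
    intro w hw
    simp only [mem_closedBall, ← ha, sub_self, zero_div, dist_zero_right, norm_div]
    exact div_le_one_of_le₀ (hle w hw) (norm_nonneg _)
  have hS := Complex.dist_le_div_mul_dist_of_mapsTo_ball hψ hmaps hzr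
  simp only [← ha, sub_self, zero_div, dist_zero_right, norm_div] at hS
  have hhalf : 1 / r * dist z c ≤ 1 / 2 := by
    have := mem_ball.1 hz
    rw [one_div, inv_mul_le_iff₀ hr]
    linarith
  have hp : 0 < ‖v z + (starRingEnd ℂ) a‖ := norm_pos_iff.2 (hden z hzr)
  have h3 : ‖v z - a‖ ≤ 1 / 2 * ‖v z + (starRingEnd ℂ) a‖ := by
    rw [← div_le_iff₀ hp]; exact hS.trans hhalf
  obtain ⟨k1, k2⟩ := key (v z)
  have h4 : ‖v z - a‖ ^ 2 ≤ 1 / 4 * ‖v z + (starRingEnd ℂ) a‖ ^ 2 := by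
    nlinarith [norm_nonneg (v z - a)]
  rw [k1, k2] at h4
  have h1 := hv z hzr
  have h2 := hv c hc
  have h5 : (2 * ((v z).re - a.re)) ^ 2 ≤ ((v z).re + a.re) ^ 2 := by
    nlinarith [sq_nonneg ((v z).im - a.im)]
  have h6 := abs_le.1 (abs_le_of_sq_le_sq h5 (by rw [ha]; linarith))
  constructor <;> linarith [h6.1, h6.2]

/-- **Harnack's inequality** for the positive harmonic function `log ‖h‖`. -/
theorem log_norm_le_three_mul {h : ℂ → ℂ} {c z : ℂ} {r : ℝ}
    (hd : DifferentiableOn ℂ h (ball c r)) (h1 : ∀ z ∈ ball c r, 1 < ‖h z‖)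
    (hz : z ∈ ball c (r / 2)) :
    Real.log ‖h z‖ ≤ 3 * Real.log ‖h c‖ ∧ Real.log ‖h c‖ ≤ 3 * Real.log ‖h z‖ := by
  have hr : 0 < r := by linarith [dist_nonneg.trans_lt (mem_ball.1 hz)]
  have h0 : ∀ z ∈ ball c r, h z ≠ 0 := fun z hz => norm_pos_iff.1 (one_pos.trans (h1 z hz))
  obtain ⟨v, hv, hexp⟩ := exists_log_on_ball hd h0
  have hre : ∀ z ∈ ball c r, Real.log ‖h z‖ = (v z).re := by
    intro z hz
    rw [← hexp z hz, Complex.norm_exp, Real.log_exp]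
  have hzr : z ∈ ball c r := ball_subset_ball (by linarith) hz
  rw [hre z hzr, hre c (mem_ball_self hr)]
  refine re_le_three_mul_re_center
    (fun z hz => (hv z hz).differentiableAt.differentiableWithinAt) (fun z hz => ?_) hz
  rw [← hre z hz]
  exact Real.log_pos (h1 z hz)

/-- **Bloch's theorem**, with a non-optimal constant: the radius of the largest disc in the image
is controlled by the derivative at the centre alone. -/
theorem exists_ball_subset_image_of_deriv {v : ℂ → ℂ} {U : Set ℂ} (hU : IsOpen U)
    (hd : DifferentiableOn ℂ v U) {c : ℂ} {r : ℝ} (hr : 0 < r) (hcU : closedBall c r ⊆ U)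
    (hv : deriv v c ≠ 0) :
    ∃ b, ball b (r * ‖deriv v c‖ / 48) ⊆ v '' closedBall c r := by
  have hd' : DifferentiableOn ℂ (deriv v) U := hd.deriv hU
  -- The point maximizing the derivative weighted by the distance to the boundary circle.
  have hcont : ContinuousOn (fun w => (r - dist w c) * ‖deriv v w‖) (closedBall c r) :=
    (by fun_prop : Continuous fun w => r - dist w c).continuousOn.mul
      (hd'.continuousOn.mono hcU).norm
  obtain ⟨a, ha, hmax⟩ := (isCompact_closedBall c r).exists_isMaxOn
    ⟨c, mem_closedBall_self hr.le⟩ hcont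
  have hmax' : ∀ w ∈ closedBall c r,
      (r - dist w c) * ‖deriv v w‖ ≤ (r - dist a c) * ‖deriv v a‖ := fun w hw => hmax hw
  have hM := hmax' c (mem_closedBall_self hr.le)
  simp only [dist_self, sub_zero] at hM
  have hvpos : 0 < r * ‖deriv v c‖ := mul_pos hr (norm_pos_iff.2 hv)
  have hac : 0 < r - dist a c := by
    by_contra hneg
    have := mul_nonpos_of_nonpos_of_nonneg (not_lt.1 hneg) (norm_nonneg (deriv v a))
    linarith
  have hL : 0 < ‖deriv v a‖ := by
    by_contra hneg
    have := mul_nonpos_of_nonneg_of_nonpos hac.le (not_lt.1 hneg)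
    linarith
  set L := ‖deriv v a‖ with hLdef
  set s := (r - dist a c) / 2 with hs
  have hs0 : 0 < s := by positivity
  have hsub : closedBall a s ⊆ closedBall c r := by
    intro w hw
    have := dist_triangle w a c
    simp only [mem_closedBall] at hw ⊢
    linarith
  have hbound : ∀ w ∈ closedBall a s, ‖deriv v w‖ ≤ 2 * L := by
    intro w hw
    have h1 := hmax' w (hsub hw)
    have h2 := dist_triangle w a c
    have h3 : s ≤ r - dist w c := by rw [mem_closedBall] at hw; linarith
    have h4 : s * ‖deriv v w‖ ≤ s * (2 * L) := by
      calc s * ‖deriv v w‖ ≤ (r - dist w c) * ‖deriv v w‖ := by gcongr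
        _ ≤ (r - dist a c) * L := h1
        _ = s * (2 * L) := by rw [hs]; ring
    exact le_of_mul_le_mul_left h4 hs0
  have hballU : ball a s ⊆ U := (ball_subset_closedBall.trans hsub).trans hcU
  have hderiv : ∀ w ∈ ball a s, ‖deriv v w - deriv v a‖ ≤ 3 * L / s * dist w a := by
    intro w hw
    rw [← dist_eq_norm]
    refine Complex.dist_le_div_mul_dist_of_mapsTo_ball (hd'.mono hballU) ?_ hw
    intro x hx
    rw [mem_closedBall, dist_eq_norm]
    have := hbound x (ball_subset_closedBall hx)
    calc ‖deriv v x - deriv v a‖ ≤ ‖deriv v x‖ + ‖deriv v a‖ := norm_sub_le _ _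
      _ ≤ 3 * L := by linarith
  have hlin : ∀ w ∈ sphere a (s / 6), L * s / 12 ≤ ‖v w - v a‖ := by
    intro w hw
    have hconv : Convex ℝ (closedBall a (s / 6)) := convex_closedBall _ _
    have hsub6 : closedBall a (s / 6) ⊆ ball a s := closedBall_subset_ball (by linarith)
    have hmv := hconv.norm_image_sub_le_of_norm_hasDerivWithin_le
      (f := fun x => v x - deriv v a * x) (f' := fun x => deriv v x - deriv v a)
      (C := L / 2) (x := a) (y := w) (fun x hx => by
        have hx' := (hd.differentiableAt (hU.mem_nhds (hballU (hsub6 hx)))).hasDerivAt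
        have := hx'.fun_sub ((hasDerivAt_id' x).const_mul (deriv v a))
        rw [mul_one] at this
        exact this.hasDerivWithinAt)
      (fun x hx => (hderiv x (hsub6 hx)).trans (by
        have hx' : dist x a ≤ s / 6 := hx
        calc 3 * L / s * dist x a ≤ 3 * L / s * (s / 6) := by gcongr
          _ = L / 2 := by field_simp; norm_num))
      (mem_closedBall_self (by positivity)) (sphere_subset_closedBall hw)
    have hwa : ‖w - a‖ = s / 6 := by rw [← dist_eq_norm]; exact hw
    rw [hwa] at hmv
    have h7 : ‖deriv v a * (w - a)‖ = L * (s / 6) := by rw [norm_mul, hwa]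
    have h8 : deriv v a * (w - a) = (v w - v a) -
        (v w - deriv v a * w - (v a - deriv v a * a)) := by ring
    have h9 := norm_sub_le (v w - v a) (v w - deriv v a * w - (v a - deriv v a * a))
    rw [← h8, h7] at h9
    linarith
  have hcl : closedBall a (s / 6) ⊆ ball a s := closedBall_subset_ball (by linarith)
  have himg := DiffContOnCl.ball_subset_image_closedBall (f := v) (z₀ := a) (r := s / 6)
    (ε := L * s / 12) (DifferentiableOn.diffContOnCl_ball (U := U) hd (hcl.trans hballU))
    (by positivity) hlin (by
      have hne : deriv v a ≠ 0 := norm_pos_iff.1 hL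
      have h1 := (hd.differentiableAt (hU.mem_nhds (hballU (mem_ball_self hs0)))).hasDerivAt
      have h2 := h1.eventually_ne (c := v a) hne
      exact h2.frequently.filter_mono nhdsWithin_le_nhds)
  refine ⟨v a, (ball_subset_ball ?_).trans (himg.trans (image_mono ?_))⟩
  · have : r * ‖deriv v c‖ ≤ 2 * s * L := by rw [hs]; linarith
    linarith
  · exact (hcl.trans ball_subset_closedBall).trans hsub

/-- A nonvanishing holomorphic function with a large logarithmic derivative takes every value in a
round annulus: by Bloch's theorem the image of its logarithm contains a disc of radius `8`. -/
theorem exists_annulus_subset_image {h : ℂ → ℂ} {c : ℂ} {r r' : ℝ} (hr : 0 < r) (hrr : r < r')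
    (hd : DifferentiableOn ℂ h (ball c r')) (h0 : ∀ z ∈ ball c r', h z ≠ 0)
    (hbig : 384 ≤ r * ‖deriv h c / h c‖) :
    ∃ ρ : ℝ, 0 < ρ ∧ ∀ w : ℂ, ρ ≤ ‖w‖ → ‖w‖ ≤ 9 * ρ → w ∈ h '' closedBall c r := by
  obtain ⟨v, hv, hexp⟩ := exists_log_on_ball hd h0
  have hc : c ∈ ball c r' := mem_ball_self (hr.trans hrr)
  have hvd : deriv v c = deriv h c / h c := (hv c hc).deriv
  have hv0 : deriv v c ≠ 0 := by
    intro h; rw [hvd] at h; rw [h, norm_zero, mul_zero] at hbig; norm_num at hbig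
  obtain ⟨b, hb⟩ := exists_ball_subset_image_of_deriv isOpen_ball
    (fun z hz => (hv z hz).differentiableAt.differentiableWithinAt) hr
    (closedBall_subset_ball hrr) hv0
  rw [hvd] at hb
  refine ⟨Real.exp b.re, Real.exp_pos _, fun w hw1 hw2 => ?_⟩
  have hw0 : w ≠ 0 := norm_pos_iff.1 ((Real.exp_pos _).trans_le hw1)
  have hq0 : w / Complex.exp b ≠ 0 := div_ne_zero hw0 (Complex.exp_ne_zero b)
  -- The logarithm of `w` closest to `b`.
  set u := b + Complex.log (w / Complex.exp b) with hu
  have hexpu : Complex.exp u = w := by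
    rw [hu, Complex.exp_add, Complex.exp_log hq0, mul_div_cancel₀ _ (Complex.exp_ne_zero b)]
  have hnorm : ‖w / Complex.exp b‖ = ‖w‖ / Real.exp b.re := by
    rw [norm_div, Complex.norm_exp]
  have hlow : 1 ≤ ‖w / Complex.exp b‖ := by
    rw [hnorm, one_le_div (Real.exp_pos _)]; exact hw1
  have hhigh : ‖w / Complex.exp b‖ ≤ 9 := by
    rw [hnorm, div_le_iff₀ (Real.exp_pos _)]; exact hw2
  have hlog : ‖Complex.log (w / Complex.exp b)‖ < 8 := by
    have h1 : |(Complex.log (w / Complex.exp b)).re| < 4 := by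
      rw [Complex.log_re, abs_of_nonneg (Real.log_nonneg hlow)]
      refine (Real.log_le_log (by linarith) hhigh).trans_lt ?_
      rw [Real.log_lt_iff_lt_exp (by norm_num)]
      have := Real.exp_one_gt_d9
      have h4 : Real.exp 4 = Real.exp 1 ^ 4 := by rw [← Real.exp_nat_mul]; norm_num
      rw [h4]
      calc (9 : ℝ) < 2 ^ 4 := by norm_num
        _ ≤ Real.exp 1 ^ 4 := by gcongr; linarith
    have h2 : |(Complex.log (w / Complex.exp b)).im| < 4 := by
      rw [Complex.log_im]
      exact (Complex.abs_arg_le_pi _).trans_lt Real.pi_lt_four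
    exact (Complex.norm_le_abs_re_add_abs_im _).trans_lt (by linarith)
  have hub : u ∈ ball b (r * ‖deriv h c / h c‖ / 48) := by
    rw [mem_ball, dist_eq_norm, hu, add_sub_cancel_left]
    linarith
  obtain ⟨x, hx, hxu⟩ := hb hub
  exact ⟨x, hx, by rw [← hexp x (closedBall_subset_ball hrr hx), hxu, hexpu]⟩

/-- A bound for the logarithmic derivative bounds the ratio of two values. -/
theorem norm_le_exp_mul_norm_of_logDeriv_le {h : ℂ → ℂ} {c x y : ℂ} {r A : ℝ}
    (hd : DifferentiableOn ℂ h (ball c r)) (h0 : ∀ z ∈ ball c r, h z ≠ 0)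
    (hA : ∀ z ∈ ball c r, ‖deriv h z / h z‖ ≤ A) (hx : x ∈ ball c r) (hy : y ∈ ball c r) :
    ‖h y‖ ≤ Real.exp (A * ‖y - x‖) * ‖h x‖ := by
  obtain ⟨v, hv, hexp⟩ := exists_log_on_ball hd h0
  have hmv := (convex_ball c r).norm_image_sub_le_of_norm_hasDerivWithin_le
    (fun z hz => (hv z hz).hasDerivWithinAt) hA hx hy
  have hre : (v y).re - (v x).re ≤ A * ‖y - x‖ := by
    rw [← Complex.sub_re]
    exact (Complex.re_le_norm _).trans hmv
  rw [← hexp x hx, ← hexp y hy, Complex.norm_exp, Complex.norm_exp, ← Real.exp_add]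
  exact Real.exp_le_exp.2 (by linarith)

/-- **Montel's theorem** along an ultrafilter: a locally bounded family of holomorphic functions
converges locally uniformly. -/
theorem exists_tendstoLocallyUniformlyOn_of_locally_bounded (𝒰 : Ultrafilter ℕ) {E : ℕ → ℂ → ℂ}
    {V : Set ℂ}
    (hb : ∀ w ∈ V, ∃ r > 0, ∃ B : ℝ, ∀ᶠ n in (𝒰 : Filter ℕ),
      DifferentiableOn ℂ (E n) (ball w r) ∧ ∀ x ∈ ball w r, ‖E n x‖ ≤ B) :
    ∃ G : ℂ → ℂ, TendstoLocallyUniformlyOn E G 𝒰 V := by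
  have hlim : ∀ w, w ∈ V → ∃ g, Tendsto (fun n => E n w) 𝒰 (𝓝 g) := by
    intro w hw
    obtain ⟨r, hr, B, h⟩ := hb w hw
    have hK : IsCompact (closedBall (0 : ℂ) B) := isCompact_closedBall _ _
    obtain ⟨g, -, hg⟩ := hK.ultrafilter_le_nhds (𝒰.map fun n => E n w) (by
      rw [le_principal_iff, Ultrafilter.mem_coe, Ultrafilter.mem_map]
      filter_upwards [h] with n hn
      simpa using hn.2 w (mem_ball_self hr))
    exact ⟨g, hg⟩
  choose! G hG using hlim
  refine ⟨G, fun u hu w hw => ?_⟩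
  obtain ⟨ε, hε, hεu⟩ := Metric.mem_uniformity_dist.1 hu
  obtain ⟨r, hr, B, h⟩ := hb w hw
  have hB : 0 ≤ B := by
    obtain ⟨n, hn⟩ := h.exists
    exact (norm_nonneg _).trans (hn.2 w (mem_ball_self hr))
  -- By the Schwarz lemma the family is equicontinuous at `w`.
  have hclose : ∀ᶠ n in (𝒰 : Filter ℕ), ∀ y ∈ ball w r,
      dist (E n y) (E n w) ≤ 2 * B / r * dist y w := by
    filter_upwards [h] with n hn y hy
    refine Complex.dist_le_div_mul_dist_of_mapsTo_ball hn.1 (fun x hx => ?_) hy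
    rw [mem_closedBall, dist_eq_norm]
    have h1 := hn.2 x hx
    have h2 := hn.2 w (mem_ball_self hr)
    exact (norm_sub_le _ _).trans (by linarith)
  obtain ⟨δ, hδ, hδr, hδε⟩ : ∃ δ > 0, δ ≤ r ∧ 2 * B / r * δ ≤ ε / 4 := by
    refine ⟨min r (ε / 4 / (2 * B / r + 1)), by positivity, min_le_left _ _, ?_⟩
    calc 2 * B / r * min r (ε / 4 / (2 * B / r + 1))
        ≤ (2 * B / r + 1) * (ε / 4 / (2 * B / r + 1)) := by
          gcongr
          · linarith
          · exact min_le_right _ _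
      _ = ε / 4 := by field_simp
  have hsmall : ∀ᶠ n in (𝒰 : Filter ℕ), ∀ y ∈ ball w δ, dist (E n y) (E n w) ≤ ε / 4 := by
    filter_upwards [hclose] with n hn y hy
    refine (hn y (ball_subset_ball hδr hy)).trans (le_trans ?_ hδε)
    have : dist y w ≤ δ := (mem_ball.1 hy).le
    gcongr
  refine ⟨V ∩ ball w δ, inter_mem_nhdsWithin _ (ball_mem_nhds w hδ), ?_⟩
  filter_upwards [hsmall, (Metric.tendsto_nhds.1 (hG w hw)) (ε / 4) (by positivity)]
    with n hn1 hn2 y hy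
  apply hεu
  have hGy : dist (G y) (G w) ≤ ε / 4 :=
    le_of_tendsto ((hG y hy.1).dist (hG w hw)) (hsmall.mono fun m hm => hm y hy.2)
  have := hn1 y hy.2
  have h1 := dist_triangle (G y) (G w) (E n y)
  have h2 := dist_triangle (G w) (E n w) (E n y)
  rw [dist_comm (G w) (E n w), dist_comm (E n w) (E n y)] at h2
  linarith

/-! ### Growth of pseudoperiodic meromorphic functions -/

/-- An entire function which grows at most polynomially on arbitrarily large discs is a
polynomial. -/
theorem exists_polynomial_of_growth {F : ℂ → ℂ} (hF : Differentiable ℂ F) {C : ℝ} {N : ℕ}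
    (h : ∀ R₀ : ℝ, ∃ R ≥ R₀, ∀ w ∈ ball (0 : ℂ) R, ‖F w‖ ≤ C * R ^ N) :
    ∃ P : Polynomial ℂ, ∀ z, F z = P.eval z := by
  have hzero : ∀ n, n ∉ Finset.range (N + 1) → iteratedDeriv n F 0 = 0 := by
    intro n hn
    rw [Finset.mem_range, not_lt] at hn
    by_contra hne
    have hD : 0 < ‖iteratedDeriv n F 0‖ := norm_pos_iff.2 hne
    set D := ‖iteratedDeriv n F 0‖ with hDdef
    obtain ⟨R, hR, hb⟩ := h (max 1 ((n.factorial * C * 2 ^ n + 1) / D))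
    have hR1 : 1 ≤ R := (le_max_left _ _).trans hR
    have hR2 : (n.factorial * C * 2 ^ n + 1) / D ≤ R := (le_max_right _ _).trans hR
    have hR0 : 0 < R := by linarith
    have hC : 0 ≤ C * R ^ N := (norm_nonneg _).trans (hb 0 (mem_ball_self hR0))
    have hC0 : 0 ≤ C := by
      by_contra hneg
      have := mul_neg_of_neg_of_pos (not_le.1 hneg) (pow_pos hR0 N)
      linarith
    have hcau := Complex.norm_iteratedDeriv_le_of_forall_mem_sphere_norm_le (c := 0) n
      (half_pos hR0) hF.diffContOnCl (fun z hz => hb z (by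
        rw [mem_sphere] at hz; rw [mem_ball, hz]; linarith))
    rw [← hDdef, le_div_iff₀ (by positivity), div_pow, ← mul_div_assoc,
      div_le_iff₀ (by positivity)] at hcau
    have hpow : R ^ N * R ≤ R ^ n := by
      rw [← pow_succ]; exact pow_le_pow_right₀ hR1 hn
    have h1 : D * R * R ^ N ≤ (n.factorial * C * 2 ^ n) * R ^ N := by
      calc D * R * R ^ N = D * (R ^ N * R) := by ring
        _ ≤ D * R ^ n := by gcongr
        _ ≤ _ := hcau
        _ = _ := by ring
    have h2 := le_of_mul_le_mul_right h1 (by positivity)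
    rw [div_le_iff₀ hD] at hR2
    linarith
  refine ⟨∑ n ∈ Finset.range (N + 1),
    Polynomial.monomial n ((n.factorial : ℂ)⁻¹ * iteratedDeriv n F 0), fun z => ?_⟩
  rw [← Complex.taylorSeries_eq_of_entire' 0 z hF, tsum_eq_sum (s := Finset.range (N + 1))]
  · simp [Polynomial.eval_finsetSum, Polynomial.eval_monomial]
  · intro n hn
    rw [hzero n hn]
    simp

/-- `F` is a complex-valued meromorphic function in normal form representing `f : ℂ → Ĉ`: the two
agree where `F` is analytic, and `f` is infinite elsewhere. -/
structure Represents (F : ℂ → ℂ) (f : ℂ → OnePoint ℂ) : Prop where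
  nf : MeromorphicNFOn F univ
  coe : ∀ z, AnalyticAt ℂ F z → f z = (F z : OnePoint ℂ)
  infty : ∀ z, ¬ AnalyticAt ℂ F z → f z = OnePoint.infty

namespace Represents

variable {F : ℂ → ℂ} {f : ℂ → OnePoint ℂ}

theorem ne_infty_iff (hF : Represents F f) {z : ℂ} : f z ≠ OnePoint.infty ↔ AnalyticAt ℂ F z :=
  ⟨fun h => by_contra fun h' => h (hF.infty z h'), fun h => by
    rw [hF.coe z h]; exact OnePoint.coe_ne_infty _⟩

end Represents

theorem HasPseudoperiod.add_int {f : ℂ → OnePoint ℂ} {l : ℤ} (hl : HasPseudoperiod f l) (k : ℤ)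
    (z : ℂ) : f (z + k) = OnePoint.map (fun w : ℂ => w + ((k * l : ℤ) : ℂ)) (f z) := by
  have hinj : ∀ n : ℤ, Function.Injective (OnePoint.map (fun w : ℂ => w + (n : ℂ))) := fun n =>
    Option.map_injective (add_left_injective _)
  have hcomp : ∀ (m n : ℤ) (x : OnePoint ℂ), OnePoint.map (fun w : ℂ => w + (m : ℂ))
      (OnePoint.map (fun w : ℂ => w + (n : ℂ)) x) =
      OnePoint.map (fun w : ℂ => w + ((n + m : ℤ) : ℂ)) x := by
    intro m n x
    induction x using OnePoint.rec with
    | infty => rfl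
    | coe x => simp [OnePoint.map_some, add_assoc]
  induction k using Int.induction_on with
  | zero =>
    induction hx : f z using OnePoint.rec with
    | infty => simp [hx]
    | coe x => simp [hx, OnePoint.map_some]
  | succ k ih =>
    have h1 := hl (z + (k : ℤ))
    rw [ih, hcomp] at h1
    push_cast at h1 ⊢
    rw [← add_assoc, h1, add_one_mul (k : ℂ)]
  | pred k ih =>
    have h1 := hl (z + ((-k - 1 : ℤ) : ℂ))
    apply hinj l
    rw [← h1, hcomp]
    have h2 : z + ((-k - 1 : ℤ) : ℂ) + 1 = z + ((-k : ℤ) : ℂ) := by push_cast; ring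
    rw [h2, ih]
    congr 1
    ext w
    push_cast
    ring

namespace Represents

variable {F : ℂ → ℂ} {f : ℂ → OnePoint ℂ} {l : ℤ}

theorem analyticAt_add_int (hF : Represents F f) (hl : HasPseudoperiod f l) {z : ℂ} (k : ℤ) :
    AnalyticAt ℂ F (z + k) ↔ AnalyticAt ℂ F z := by
  rw [← hF.ne_infty_iff, ← hF.ne_infty_iff, hl.add_int k z]
  induction hx : f z using OnePoint.rec with
  | infty => simp
  | coe x => simp [OnePoint.map_some]

theorem apply_add_int (hF : Represents F f) (hl : HasPseudoperiod f l) {z : ℂ} (k : ℤ)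
    (hz : AnalyticAt ℂ F z) : F (z + k) = F z + k * l := by
  have h1 := hl.add_int k z
  rw [hF.coe _ ((hF.analyticAt_add_int hl k).2 hz), hF.coe z hz, OnePoint.map_some,
    OnePoint.coe_eq_coe] at h1
  rw [h1]; push_cast; rfl

/-- If `f` is finite and of at most polynomial growth on arbitrarily large discs whose centres are
integers of comparable size, then `f` is rational: by pseudoperiodicity the discs may be centred
at the origin. -/
theorem isRationalMap_of_growth (hF : Represents F f) (hl : HasPseudoperiod f l) {C : ℝ} {N : ℕ}
    (h : ∀ R₀ : ℝ, ∃ R ≥ R₀, ∃ j : ℤ, |(j : ℝ)| ≤ C * R ∧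
      ∀ w ∈ ball (j : ℂ) R, AnalyticAt ℂ F w ∧ ‖F w‖ ≤ C * R ^ N) :
    IsRationalMap f := by
  have han : ∀ z, AnalyticAt ℂ F z := by
    intro z
    obtain ⟨R, hR, j, -, hj⟩ := h (‖z‖ + 1)
    refine (hF.analyticAt_add_int hl j).1 (hj _ ?_).1
    rw [mem_ball, dist_eq_norm, add_sub_cancel_right]
    linarith
  obtain ⟨P, hP⟩ := exists_polynomial_of_growth (F := F) (C := C + C * |(l : ℝ)|) (N := N + 1)
    (fun z => (han z).differentiableAt) (fun R₀ => by
      obtain ⟨R, hR, j, hjC, hj⟩ := h (max R₀ 1)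
      have hR1 : 1 ≤ R := (le_max_right _ _).trans hR
      refine ⟨R, (le_max_left _ _).trans hR, fun w hw => ?_⟩
      have hwj : w + j ∈ ball (j : ℂ) R := by
        rw [mem_ball, dist_eq_norm] at hw ⊢
        simpa using hw
      have h1 := (hj _ hwj).2
      have hCR : 0 ≤ C * R ^ N := (norm_nonneg _).trans h1
      have hC : 0 ≤ C := by
        by_contra hneg
        have := mul_neg_of_neg_of_pos (not_le.1 hneg) (pow_pos (by linarith : 0 < R) N)
        linarith
      rw [hF.apply_add_int hl j (han w)] at h1
      have h2 : ‖F w‖ ≤ ‖F w + j * l‖ + ‖(j * l : ℂ)‖ := by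
        simpa using norm_sub_le (F w + j * l) (j * l : ℂ)
      have h3 : ‖(j * l : ℂ)‖ = |(j : ℝ)| * |(l : ℝ)| := by
        rw [norm_mul, Complex.norm_intCast, Complex.norm_intCast]
      have h4 : R ^ N ≤ R ^ (N + 1) := pow_le_pow_right₀ hR1 (Nat.le_succ N)
      have h5 : R ≤ R ^ (N + 1) := le_self_pow₀ hR1 (Nat.succ_ne_zero N)
      calc ‖F w‖ ≤ C * R ^ N + |(j : ℝ)| * |(l : ℝ)| := by rw [h3] at h2; linarith
        _ ≤ C * R ^ (N + 1) + C * R ^ (N + 1) * |(l : ℝ)| := by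
          gcongr
          exact hjC.trans (by gcongr)
        _ = _ := by ring)
  refine ⟨P, 1, one_ne_zero, fun z _ => ?_⟩
  rw [hF.coe z (han z), hP z]
  simp

end Represents

/-! ### Winding around the origin -/

theorem expOne_ne_zero (z : ℂ) : expOne z ≠ 0 := Complex.exp_ne_zero _

theorem expOne_add_int (z : ℂ) (q : ℤ) : expOne (z + q) = expOne z := by
  rw [expOne, expOne, Complex.exp_eq_exp_iff_exists_int]
  exact ⟨q, by ring⟩

theorem continuous_expOne : Continuous expOne := by
  unfold expOne
  fun_prop

/-- The curve `Γ` does not wind around `w`: `Γ - w` has a logarithm with equal end values. -/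
def HasClosedLog (Γ : unitInterval → ℂ) (w : ℂ) : Prop :=
  ∃ L : unitInterval → ℂ, Continuous L ∧ (∀ t, Complex.exp (L t) = Γ t - w) ∧ L 1 = L 0

/-- Moving `w` by less than its distance to the curve keeps the winding number zero: the quotient of
`Γ - w'` and `Γ - w` stays in the slit plane. -/
theorem HasClosedLog.of_norm_sub_lt {Γ : unitInterval → ℂ} (hΓ : Continuous Γ) (h01 : Γ 1 = Γ 0)
    {w w' : ℂ} (hw : HasClosedLog Γ w) (hd : ∀ t, ‖w' - w‖ < ‖Γ t - w‖) : HasClosedLog Γ w' := by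
  obtain ⟨L, hL, hexp, hL01⟩ := hw
  have hne : ∀ t, Γ t - w ≠ 0 := fun t => norm_pos_iff.1 ((norm_nonneg _).trans_lt (hd t))
  have hslit : ∀ t, 1 + (w - w') / (Γ t - w) ∈ Complex.slitPlane := by
    intro t
    apply Complex.mem_slitPlane_of_norm_lt_one
    rw [norm_div, div_lt_one (norm_pos_iff.2 (hne t)), norm_sub_rev]
    exact hd t
  refine ⟨fun t => L t + Complex.log (1 + (w - w') / (Γ t - w)), ?_, fun t => ?_, ?_⟩
  · refine hL.add (Continuous.clog ?_ hslit)
    exact continuous_const.add (continuous_const.div (hΓ.sub continuous_const) hne)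
  · rw [Complex.exp_add, Complex.exp_log (Complex.slitPlane_ne_zero (hslit t)), hexp]
    field_simp [hne t]
    ring
  · simp only [h01, hL01]

/-- A curve does not wind around a point of modulus larger than all its values. -/
theorem hasClosedLog_of_forall_norm_lt {Γ : unitInterval → ℂ} (hΓ : Continuous Γ)
    (h01 : Γ 1 = Γ 0) {w : ℂ} (hw : ∀ t, ‖Γ t‖ < ‖w‖) : HasClosedLog Γ w := by
  have hw0 : w ≠ 0 := norm_pos_iff.1 ((norm_nonneg _).trans_lt (hw 0))
  have hslit : ∀ t, 1 + -(Γ t / w) ∈ Complex.slitPlane := by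
    intro t
    apply Complex.mem_slitPlane_of_norm_lt_one
    rw [norm_neg, norm_div, div_lt_one (norm_pos_iff.2 hw0)]
    exact hw t
  refine ⟨fun t => Complex.log (-w) + Complex.log (1 + -(Γ t / w)), ?_, fun t => ?_, ?_⟩
  · exact continuous_const.add (Continuous.clog (by fun_prop) hslit)
  · rw [Complex.exp_add, Complex.exp_log (Complex.slitPlane_ne_zero (hslit t)),
      Complex.exp_log (neg_ne_zero.2 hw0)]
    field_simp
    ring
  · simp only [h01]

/-- The lift of a closed curve not winding around the origin is closed. -/
theorem HasClosedLog.lift_closed {γ : unitInterval → ℂ} (hγ : Continuous γ)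
    (h : HasClosedLog (fun t => expOne (γ t)) 0) : γ 1 = γ 0 := by
  obtain ⟨L, hL, hexp, hL01⟩ := h
  have hn : ∀ t, ∃ n : ℤ, L t = 2 * Real.pi * Complex.I * γ t + n * (2 * Real.pi * Complex.I) := by
    intro t
    rw [← Complex.exp_eq_exp_iff_exists_int, hexp t, sub_zero]
    rfl
  choose n hn using hn
  have h2 : (2 * Real.pi * Complex.I : ℂ) ≠ 0 := Complex.two_pi_I_ne_zero
  have hnc : Continuous n := by
    rw [Int.isClosedEmbedding_coe_real.isEmbedding.continuous_iff]
    have : (fun t => ((n t : ℤ) : ℝ)) = fun t => (L t / (2 * Real.pi * Complex.I) - γ t).re := by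
      ext t
      rw [hn t, add_div, mul_div_cancel_left₀ _ h2, mul_div_cancel_right₀ _ h2]
      simp
    change Continuous fun t => ((n t : ℤ) : ℝ)
    rw [this]
    fun_prop
  have hconst : n 1 = n 0 := PreconnectedSpace.constant inferInstance hnc
  have h1 := hn 1
  rw [hL01, hn 0, hconst] at h1
  exact (mul_left_cancel₀ h2 (add_right_cancel h1)).symm

/-- If a plane domain contains two points differing by a nonzero integer, then its image under
`exp₁` contains a closed curve winding around the origin, so the origin lies in the fill. -/
theorem zero_mem_fill_of_add_int_mem {U : Set ℂ} (hUo : IsOpen U) (hUc : IsPreconnected U) {z : ℂ}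
    {q : ℤ} (hq : q ≠ 0) (hz : z ∈ U) (hzq : z + q ∈ U) : (0 : ℂ) ∈ fill (expOne '' U) := by
  obtain ⟨γ, hγ⟩ := (hUo.isConnected_iff_isPathConnected.1 ⟨⟨z, hz⟩, hUc⟩).joinedIn z hz _ hzq
  have h0 : (0 : ℂ) ∈ (expOne '' U)ᶜ := by
    rintro ⟨w, -, hw⟩
    exact expOne_ne_zero w hw
  refine Or.inr ⟨h0, ?_⟩
  by_contra hunb
  have hΓ : Continuous fun t => expOne (γ t) := continuous_expOne.comp γ.continuous
  have h01 : expOne (γ 1) = expOne (γ 0) := by simp [expOne_add_int]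
  have hcompact : IsCompact (range fun t => expOne (γ t)) := isCompact_range hΓ
  have hsub : ∀ w ∈ connectedComponentIn (expOne '' U)ᶜ 0,
      w ∉ range fun t => expOne (γ t) := by
    rintro w hw ⟨t, rfl⟩
    exact connectedComponentIn_subset _ _ hw ⟨_, hγ t, rfl⟩
  -- The winding number is constant on the component and vanishes far from the curve.
  obtain ⟨M, hM⟩ := hcompact.isBounded.exists_norm_le
  obtain ⟨w, hw, hwM⟩ : ∃ w ∈ connectedComponentIn (expOne '' U)ᶜ 0, M < ‖w‖ := by
    by_contra! hle
    exact hunb (isBounded_iff_forall_norm_le.2 ⟨M, hle⟩)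
  have hfar : HasClosedLog (fun t => expOne (γ t)) w :=
    hasClosedLog_of_forall_norm_lt hΓ h01 fun t => (hM _ ⟨t, rfl⟩).trans_lt hwM
  have hzero : HasClosedLog (fun t => expOne (γ t)) 0 := by
    refine isPreconnected_connectedComponentIn.induction₂'
      (fun x y => HasClosedLog (fun t => expOne (γ t)) x → HasClosedLog (fun t => expOne (γ t)) y)
      (fun x hx => ?_) (fun _ _ _ _ _ _ h1 h2 h => h2 (h1 h)) hw (mem_connectedComponentIn h0) hfar
    obtain ⟨ε, hε, hball⟩ := Metric.isOpen_iff.1 hcompact.isClosed.isOpen_compl x (hsub x hx)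
    have hfar' : ∀ t, ε ≤ ‖expOne (γ t) - x‖ := by
      intro t
      by_contra! hlt
      exact hball (by rwa [mem_ball, dist_eq_norm]) ⟨t, rfl⟩
    filter_upwards [nhdsWithin_le_nhds (ball_mem_nhds x (half_pos hε))] with y hy
    rw [mem_ball, dist_eq_norm] at hy
    refine ⟨fun h => h.of_norm_sub_lt hΓ h01 fun t => ?_,
      fun h => h.of_norm_sub_lt hΓ h01 fun t => ?_⟩
    · linarith [hfar' t]
    · have h1 := norm_sub_le_norm_sub_add_norm_sub (expOne (γ t)) y x
      rw [norm_sub_rev]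
      linarith [hfar' t]
  have := hzero.lift_closed γ.continuous
  simp only [Path.target, Path.source, add_eq_left, Int.cast_eq_zero] at this
  exact hq this

/-! ### Locally uniform convergence into the sphere -/

/-- Locally uniform convergence of continuous maps on an open set is the same as continuous
convergence: joint convergence as the index tends to infinity and the point tends to `w`. -/
theorem tendstoLocallyUniformlyOn_iff_tendsto_prod {β : Type*} [UniformSpace β]
    {φ : ℕ → ℂ → β} {h : ℂ → β} {W : Set ℂ} (hW : IsOpen W) (hφ : ∀ n, ContinuousOn (φ n) W) :
    TendstoLocallyUniformlyOn φ h atTop W ↔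
      ∀ w ∈ W, Tendsto (fun p : ℕ × ℂ => φ p.1 p.2) (atTop ×ˢ 𝓝 w) (𝓝 (h w)) := by
  constructor
  · intro H w hw
    have hc : ContinuousOn h W := H.continuousOn (Eventually.of_forall hφ).frequently
    have h1 : ContinuousWithinAt h univ w :=
      (hc.continuousAt (hW.mem_nhds hw)).continuousWithinAt
    refine tendsto_comp_of_locally_uniform_limit_within (F := fun p : ℕ × ℂ => φ p.1)
      (g := fun p : ℕ × ℂ => p.2) h1 ?_ ?_
    · rw [nhdsWithin_univ]; exact tendsto_snd
    · intro u hu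
      obtain ⟨t, ht, hn⟩ := H u hu w hw
      rw [hW.nhdsWithin_eq hw] at ht
      exact ⟨t, by rwa [nhdsWithin_univ], tendsto_fst.eventually hn⟩
  · intro H u hu x hx
    obtain ⟨v, hv, hvs, hvu⟩ := comp_symm_mem_uniformity_sets hu
    obtain ⟨v', hv', hvs', hvu'⟩ := comp_symm_mem_uniformity_sets hv
    have h1 : ∀ᶠ p : ℕ × ℂ in atTop ×ˢ 𝓝 x, (h x, φ p.1 p.2) ∈ v' :=
      (H x hx).eventually (mem_nhds_left _ hv')
    obtain ⟨pa, ha, pb, hb, hab⟩ := eventually_prod_iff.1 h1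
    refine ⟨{y | pb y} ∩ W, inter_mem (mem_nhdsWithin_of_mem_nhds hb) self_mem_nhdsWithin, ?_⟩
    have hlim : ∀ y, pb y → y ∈ W → (h x, h y) ∈ v := by
      intro y hy hyW
      have h2 : ∀ᶠ n in atTop, (h y, φ n y) ∈ v' := by
        have : Tendsto (fun n => φ n y) atTop (𝓝 (h y)) :=
          (H y hyW).comp (tendsto_id.prodMk tendsto_const_nhds)
        exact this.eventually (mem_nhds_left _ hv')
      obtain ⟨n, hn1, hn2⟩ := (ha.and h2).exists
      exact hvu' (SetRel.prodMk_mem_comp (hab hn1 hy) (SetRel.symm v' hn2))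
    filter_upwards [ha] with n hn y hy
    refine hvu (SetRel.prodMk_mem_comp (SetRel.symm v (hlim y hy.1 hy.2)) ?_)
    have hrefl : v' ⊆ v := by
      intro p hp
      exact hvu' (SetRel.prodMk_mem_comp (mem_uniformity_of_eq hv' rfl) hp)
    exact hrefl (hab hn hy.1)

theorem sphereTendsto_iff_tendsto_prod {φ : ℕ → ℂ → OnePoint ℂ} {h : ℂ → OnePoint ℂ} {W : Set ℂ}
    (hW : IsOpen W) (hφ : ∀ n, ContinuousOn (φ n) W) :
    SphereTendsto φ h W ↔
      ∀ w ∈ W, Tendsto (fun p : ℕ × ℂ => φ p.1 p.2) (atTop ×ˢ 𝓝 w) (𝓝 (h w)) :=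
  @tendstoLocallyUniformlyOn_iff_tendsto_prod (OnePoint ℂ) uniformSpaceOfCompactR1 φ h W hW hφ

theorem tendsto_coe_nhds_infty_iff {ι : Type*} {a : ι → ℂ} {L : Filter ι} :
    Tendsto (fun i => (a i : OnePoint ℂ)) L (𝓝 OnePoint.infty) ↔
      Tendsto (fun i => ‖a i‖) L atTop := by
  rw [tendsto_norm_atTop_iff_cobounded, Metric.cobounded_eq_cocompact,
    ← coclosedCompact_eq_cocompact, ← OnePoint.comap_coe_nhds_infty, tendsto_comap_iff]
  rfl

/-! ### Iterates and the Fatou set -/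

theorem iter_succ' (f : ℂ → OnePoint ℂ) (n : ℕ) (z : ℂ) :
    iter f (n + 1) z = (f z).elim OnePoint.infty (iter f n) := by
  induction n with
  | zero =>
    simp only [iter, OnePoint.elim_some]
    induction hx : f z using OnePoint.rec with
    | infty => rfl
    | coe x => rfl
  | succ n ih =>
    rw [iter, ih]
    induction hx : f z using OnePoint.rec with
    | infty => rfl
    | coe x => rfl

theorem HasPseudoperiod.iter_add_int {f : ℂ → OnePoint ℂ} {l : ℤ} (hl : HasPseudoperiod f l)
    (n : ℕ) (k : ℤ) (z : ℂ) : iter f n (z + k) =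
      OnePoint.map (fun w : ℂ => w + ((k * l ^ n : ℤ) : ℂ)) (iter f n z) := by
  induction n with
  | zero => simp [iter, OnePoint.map_some]
  | succ n ih =>
    rw [iter, iter, ih]
    induction hx : iter f n z using OnePoint.rec with
    | infty => rfl
    | coe x =>
      rw [OnePoint.map_some, OnePoint.elim_some, OnePoint.elim_some, hl.add_int, pow_succ,
        mul_assoc]

theorem isOpen_fatouSet (f : ℂ → OnePoint ℂ) : IsOpen (fatouSet f) :=
  isOpen_sUnion fun _ h => h.1

theorem IteratesNormalOn.mono {f : ℂ → OnePoint ℂ} {W W' : Set ℂ} (h : IteratesNormalOn f W)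
    (hW : W' ⊆ W) : IteratesNormalOn f W' := by
  refine ⟨fun n z hz => h.1 n z (hW hz), fun s => ?_⟩
  obtain ⟨t, ht, φ, hφ⟩ := h.2 s
  exact ⟨t, ht, φ, @TendstoLocallyUniformlyOn.mono _ _ _ _ uniformSpaceOfCompactR1 _ _ _ _ _ hφ hW⟩

/-- The iterates are defined and normal on a whole disc around a point of the Fatou set. -/
theorem exists_ball_of_mem_fatouSet {f : ℂ → OnePoint ℂ} {z : ℂ} (hz : z ∈ fatouSet f) :
    ∃ r > 0, ball z r ⊆ fatouSet f ∧ IteratesNormalOn f (ball z r) := by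
  obtain ⟨W, ⟨hWo, hW⟩, hzW⟩ := hz
  obtain ⟨r, hr, hrW⟩ := Metric.isOpen_iff.1 hWo z hzW
  exact ⟨r, hr, hrW.trans (subset_sUnion_of_mem ⟨hWo, hW⟩), hW.mono hrW⟩

theorem iter_ne_infty_of_mem_fatouSet {f : ℂ → OnePoint ℂ} {z : ℂ} (hz : z ∈ fatouSet f) (n : ℕ) :
    iter f n z ≠ OnePoint.infty := by
  obtain ⟨W, ⟨-, hW⟩, hzW⟩ := hz
  exact hW.1 (n + 1) z hzW n (Nat.lt_succ_self n)

namespace Represents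

variable {F : ℂ → ℂ} {f : ℂ → OnePoint ℂ} {l : ℤ}

theorem iter_eq_of_ne_infty (hF : Represents F f) {z : ℂ} (h : ∀ n, iter f n z ≠ OnePoint.infty)
    (n : ℕ) : iter f n z = (F^[n] z : OnePoint ℂ) ∧ AnalyticAt ℂ F (F^[n] z) := by
  have key : ∀ n, iter f n z = (F^[n] z : OnePoint ℂ) → AnalyticAt ℂ F (F^[n] z) := by
    intro n hn
    have h1 := h (n + 1)
    rw [iter, hn, OnePoint.elim_some] at h1
    exact hF.ne_infty_iff.1 h1
  induction n with
  | zero => exact ⟨rfl, key 0 rfl⟩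
  | succ n ih =>
    have h1 : iter f (n + 1) z = (F^[n + 1] z : OnePoint ℂ) := by
      rw [iter, ih.1, OnePoint.elim_some, hF.coe _ ih.2, Function.iterate_succ_apply']
    exact ⟨h1, key _ h1⟩

theorem iter_eq (hF : Represents F f) {z : ℂ} (hz : z ∈ fatouSet f) (n : ℕ) :
    iter f n z = (F^[n] z : OnePoint ℂ) :=
  (hF.iter_eq_of_ne_infty (iter_ne_infty_of_mem_fatouSet hz) n).1

theorem analyticAt (hF : Represents F f) {z : ℂ} (hz : z ∈ fatouSet f) : AnalyticAt ℂ F z :=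
  (hF.iter_eq_of_ne_infty (iter_ne_infty_of_mem_fatouSet hz) 0).2

theorem analyticAt_iterate (hF : Represents F f) {z : ℂ} (hz : z ∈ fatouSet f) (n : ℕ) :
    AnalyticAt ℂ (F^[n]) z := by
  induction n with
  | zero => exact analyticAt_id
  | succ n ih =>
    rw [Function.iterate_succ']
    exact (hF.iter_eq_of_ne_infty (iter_ne_infty_of_mem_fatouSet hz) n).2.comp ih

theorem differentiableOn_iterate (hF : Represents F f) {V : Set ℂ} (hV : V ⊆ fatouSet f) (n : ℕ) :
    DifferentiableOn ℂ (F^[n]) V := fun _ hz =>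
  (hF.analyticAt_iterate (hV hz) n).differentiableAt.differentiableWithinAt

theorem continuousOn_iter (hF : Represents F f) {V : Set ℂ} (hV : V ⊆ fatouSet f) (n : ℕ) :
    ContinuousOn (iter f n) V := by
  refine ContinuousOn.congr (f := fun z => (F^[n] z : OnePoint ℂ)) ?_
    fun z hz => hF.iter_eq (hV hz) n
  exact OnePoint.continuous_coe.comp_continuousOn (hF.differentiableOn_iterate hV n).continuousOn

/-! ### Invariance of the Fatou set -/

/-- A non-rational meromorphic function is open at the points where it is finite. -/
theorem nhds_le_map_nhds (hF : Represents F f) (hf : ¬ IsRationalMap f) {x : ℂ}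
    (hx : AnalyticAt ℂ F x) : 𝓝 (F x) ≤ map F (𝓝 x) := by
  refine hx.eventually_constant_or_nhds_le_map_nhds.resolve_left fun hconst => hf ?_
  set c := F x with hc
  have hmero : MeromorphicOn (fun y => F y - c) univ := fun y _ =>
    (hF.nf (mem_univ y)).meromorphicAt.sub (MeromorphicAt.const c y)
  have htop : meromorphicOrderAt (fun y => F y - c) x = ⊤ := by
    rw [meromorphicOrderAt_eq_top_iff]
    filter_upwards [nhdsWithin_le_nhds hconst] with y hy
    rw [hy, sub_self]
  have hall : ∀ y, F =ᶠ[𝓝 y] fun _ => c := by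
    intro y
    have hy : meromorphicOrderAt (fun y => F y - c) y = ⊤ := by
      by_contra hne
      exact hmero.meromorphicOrderAt_ne_top_of_isPreconnected isPreconnected_univ (mem_univ y)
        (mem_univ x) hne htop
    rw [meromorphicOrderAt_eq_top_iff] at hy
    refine ((hF.nf (mem_univ y)).eventuallyEq_nhdsNE_iff_eventuallyEq_nhds
      analyticAt_const.meromorphicNFAt).1 ?_
    filter_upwards [hy] with w hw
    exact sub_eq_zero.1 hw
  refine ⟨Polynomial.C c, 1, one_ne_zero, fun y _ => ?_⟩
  rw [hF.coe y (analyticAt_const.congr (hall y).symm), (hall y).eq_of_nhds]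
  simp

/-- The Fatou set is forward invariant: since `F` is open, a neighbourhood of `F z` is the image of
a neighbourhood of `z`, on which the shifted iterates are normal. -/
theorem mapsTo_fatouSet (hF : Represents F f) (hf : ¬ IsRationalMap f) :
    MapsTo F (fatouSet f) (fatouSet f) := by
  intro z hz
  obtain ⟨r, hr, hrf, hdef, hnorm⟩ := exists_ball_of_mem_fatouSet hz
  have hcomp : ∀ x ∈ ball z r, ∀ n, iter f n (F x) = iter f (n + 1) x := by
    intro x hx n
    rw [iter_succ', hF.coe x (hF.analyticAt (hrf hx)), OnePoint.elim_some]
  have hopen : IsOpen (F '' ball z r) := by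
    rw [isOpen_iff_mem_nhds]
    rintro _ ⟨x, hx, rfl⟩
    exact hF.nhds_le_map_nhds hf (hF.analyticAt (hrf hx))
      (image_mem_map (isOpen_ball.mem_nhds hx))
  refine ⟨F '' ball z r, ⟨hopen, ?_, fun s => ?_⟩, ⟨z, mem_ball_self hr, rfl⟩⟩
  · rintro n _ ⟨x, hx, rfl⟩ m hm
    rw [hcomp x hx]
    exact iter_ne_infty_of_mem_fatouSet (hrf hx) _
  · obtain ⟨t, ht, h, hh⟩ := hnorm fun k => s k + 1
    rw [sphereTendsto_iff_tendsto_prod isOpen_ball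
      fun n => hF.continuousOn_iter hrf _] at hh
    -- The limit at `F x` is the limit of the shifted sequence at any chosen preimage.
    choose! ψ hψ hψF using fun y (hy : y ∈ F '' ball z r) => hy
    refine ⟨t, ht, fun y => h (ψ y), ?_⟩
    have hprod : ∀ y ∈ F '' ball z r, Tendsto (fun p : ℕ × ℂ => iter f (s (t p.1)) p.2)
        (atTop ×ˢ 𝓝 y) (𝓝 (h (ψ y))) := by
      intro y hy
      have h1 := hh (ψ y) (hψ y hy)
      have h2 : Tendsto (fun p : ℕ × ℂ => iter f (s (t p.1)) (F p.2)) (atTop ×ˢ 𝓝 (ψ y))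
          (𝓝 (h (ψ y))) := by
        refine h1.congr' ?_
        filter_upwards [tendsto_snd.eventually (isOpen_ball.mem_nhds (hψ y hy))] with p hp
        exact (hcomp p.2 hp _).symm
      have h3 : atTop ×ˢ 𝓝 y ≤ map (Prod.map id F) ((atTop : Filter ℕ) ×ˢ 𝓝 (ψ y)) := by
        rw [← prod_map_map_eq', map_id]
        refine prod_mono le_rfl ?_
        conv_lhs => rw [← hψF y hy]
        exact hF.nhds_le_map_nhds hf (hF.analyticAt (hrf (hψ y hy)))
      exact (tendsto_map'_iff.2 h2).mono_left h3
    refine (sphereTendsto_iff_tendsto_prod hopen fun n => ?_).2 hprod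
    rintro _ ⟨x, hx, rfl⟩
    refine ContinuousAt.continuousWithinAt ?_
    have h1 : Tendsto (fun x => iter f (s (t n)) (F x)) (𝓝 x) (𝓝 (iter f (s (t n)) (F x))) := by
      have h2 := (hF.continuousOn_iter hrf (s (t n) + 1)).continuousAt (isOpen_ball.mem_nhds hx)
      rw [ContinuousAt, ← hcomp x hx] at h2
      refine h2.congr' ?_
      filter_upwards [isOpen_ball.mem_nhds hx] with p hp
      exact (hcomp p hp _).symm
    exact (tendsto_map'_iff.2 h1).mono_left (hF.nhds_le_map_nhds hf (hF.analyticAt (hrf hx)))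

theorem iterate_mem_fatouSet (hF : Represents F f) (hf : ¬ IsRationalMap f) {z : ℂ}
    (hz : z ∈ fatouSet f) (n : ℕ) : F^[n] z ∈ fatouSet f :=
  (hF.mapsTo_fatouSet hf).iterate n hz

/-- If `ℓ = ±1`, then `fⁿ(z + k)` and `fⁿ(z)` differ by one of the two constants `±k`, so the Fatou
set is invariant under integer translations. -/
theorem add_int_mem_fatouSet (hF : Represents F f) (hl : HasPseudoperiod f l) (hl1 : l = 1 ∨ l = -1)
    {z : ℂ} (hz : z ∈ fatouSet f) (k : ℤ) : z + k ∈ fatouSet f := by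
  obtain ⟨r, hr, hrf, hdef, hnorm⟩ := exists_ball_of_mem_fatouSet hz
  have hmem : ∀ y ∈ ball (z + k) r, y - k ∈ ball z r := by
    intro y hy
    rw [mem_ball, dist_eq_norm] at hy ⊢
    rwa [sub_sub, add_comm (k : ℂ)]
  have hshift : ∀ (y : ℂ) (n : ℕ), iter f n y =
      OnePoint.map (fun w : ℂ => w + ((k * l ^ n : ℤ) : ℂ)) (iter f n (y - k)) := by
    intro y n
    rw [← hl.iter_add_int, sub_add_cancel]
  have hT : ∀ c : ℂ, Continuous (OnePoint.map fun w : ℂ => w + c) := fun c =>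
    OnePoint.continuous_map (continuous_add_const c) (by
      rw [coclosedCompact_eq_cocompact]
      exact (Homeomorph.addRight c).isClosedEmbedding.tendsto_cocompact)
  refine ⟨ball (z + k) r, ⟨isOpen_ball, ?_, fun s => ?_⟩, mem_ball_self hr⟩
  · intro n y hy m hm
    rw [hshift y m, hF.iter_eq (hrf (hmem y hy)), OnePoint.map_some]
    exact OnePoint.coe_ne_infty _
  · obtain ⟨t, ht, h, hh⟩ := hnorm s
    rw [sphereTendsto_iff_tendsto_prod isOpen_ball fun n => hF.continuousOn_iter hrf _] at hh
    obtain ⟨e, he⟩ : ∃ e : ℤ, ∃ᶠ n in atTop, l ^ s (t n) = e := by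
      by_contra hcon
      simp only [not_exists, not_frequently] at hcon
      obtain ⟨n, hn1, hn2⟩ := ((hcon 1).and (hcon (-1))).exists
      rcases hl1 with rfl | rfl
      · exact hn1 (one_pow _)
      · exact (neg_one_pow_eq_or ℤ (s (t n))).elim hn1 hn2
    obtain ⟨u, hu, hue⟩ := extraction_of_frequently_atTop he
    refine ⟨t ∘ u, ht.comp hu, fun y => OnePoint.map (fun w : ℂ => w + ((k * e : ℤ) : ℂ))
      (h (y - k)), ?_⟩
    refine (sphereTendsto_iff_tendsto_prod isOpen_ball fun n => ?_).2 fun y hy => ?_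
    · refine ContinuousOn.congr (f := fun y => OnePoint.map
        (fun w : ℂ => w + ((k * l ^ s (t (u n)) : ℤ) : ℂ)) (iter f (s (t (u n))) (y - k))) ?_
        fun y _ => hshift y _
      exact (hT _).comp_continuousOn ((hF.continuousOn_iter hrf _).comp
        (continuous_sub_right _).continuousOn hmem)
    · have h1 := hh (y - k) (hmem y hy)
      have h2 : Tendsto (fun p : ℕ × ℂ => (u p.1, p.2 - (k : ℂ))) (atTop ×ˢ 𝓝 y)
          (atTop ×ˢ 𝓝 (y - k)) :=
        hu.tendsto_atTop.prodMap ((continuous_sub_right (k : ℂ)).tendsto y)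
      refine (((hT _).tendsto _).comp (h1.comp h2)).congr fun p => ?_
      simp only [Function.comp]
      rw [hshift p.2, hue]

end Represents

theorem mem_connectedComponentIn_of_mapsTo {S : Set ℂ} {G : ℂ → ℂ} (hG : ContinuousOn G S)
    (hGS : MapsTo G S S) {z w : ℂ} (hw : w ∈ connectedComponentIn S z) :
    G w ∈ connectedComponentIn S (G z) := by
  have hz : z ∈ S := connectedComponentIn_nonempty_iff.1 ⟨w, hw⟩
  have hsub := connectedComponentIn_subset S z
  refine (isPreconnected_connectedComponentIn.image G (hG.mono hsub)).subset_connectedComponentIn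
    ⟨z, mem_connectedComponentIn hz, rfl⟩ ?_ ⟨w, hw, rfl⟩
  rintro _ ⟨x, hx, rfl⟩
  exact hGS (hsub hx)

/-! ### Escaping components -/

namespace Represents

variable {F : ℂ → ℂ} {f : ℂ → OnePoint ℂ} {l : ℤ}

/-- A limit function of the iterates on a connected open set that is infinite somewhere is infinite
everywhere: by Harnack's inequality for `log ‖fⁿ‖` the set where it is infinite is open. -/
theorem limit_eq_infty (hF : Represents F f) {W : Set ℂ} (hWo : IsOpen W) (hWc : IsPreconnected W)
    (hW : W ⊆ fatouSet f) {s : ℕ → ℕ} {h : ℂ → OnePoint ℂ}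
    (hs : ∀ w ∈ W, Tendsto (fun p : ℕ × ℂ => iter f (s p.1) p.2) (atTop ×ˢ 𝓝 w) (𝓝 (h w)))
    {x y : ℂ} (hx : x ∈ W) (hy : y ∈ W) (hxi : h x = OnePoint.infty) : h y = OnePoint.infty := by
  have hpt : ∀ w ∈ W, Tendsto (fun n => iter f (s n) w) atTop (𝓝 (h w)) := fun w hw =>
    (hs w hw).comp (tendsto_id.prodMk tendsto_const_nhds)
  refine hWc.induction₂' (fun x y => h x = OnePoint.infty → h y = OnePoint.infty)
    (fun x hx => ?_) (fun _ _ _ _ _ _ h1 h2 h => h2 (h1 h)) hx hy hxi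
  rw [hWo.nhdsWithin_eq hx]
  by_cases hxi : h x = OnePoint.infty
  · suffices ∀ᶠ y in 𝓝 x, h y = OnePoint.infty from
      this.mono fun y hy => ⟨fun _ => hy, fun _ => hxi⟩
    have h1 := hs x hx
    rw [hxi] at h1
    have h2 : Tendsto (fun p : ℕ × ℂ => ‖F^[s p.1] p.2‖) (atTop ×ˢ 𝓝 x) atTop := by
      rw [← tendsto_coe_nhds_infty_iff]
      refine h1.congr' ?_
      filter_upwards [tendsto_snd.eventually (hWo.mem_nhds hx)] with p hp
      exact hF.iter_eq (hW hp) _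
    obtain ⟨pa, ha, pb, hb, hab⟩ := eventually_prod_iff.1 (h2.eventually_gt_atTop 1)
    obtain ⟨r, hr, hrb⟩ := Metric.mem_nhds_iff.1 (inter_mem hb (hWo.mem_nhds hx))
    filter_upwards [ball_mem_nhds x (half_pos hr)] with y hy
    have hyW : y ∈ W := (hrb (ball_subset_ball (by linarith) hy)).2
    refine tendsto_nhds_unique (hpt y hyW) ?_
    have h3 : Tendsto (fun n => ‖F^[s n] y‖) atTop atTop := by
      have h4 : Tendsto (fun n => Real.log ‖F^[s n] x‖) atTop atTop :=
        Real.tendsto_log_atTop.comp (h2.comp (tendsto_id.prodMk tendsto_const_nhds))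
      have h5 : Tendsto (fun n => Real.log ‖F^[s n] y‖) atTop atTop := by
        refine tendsto_atTop_mono' _ ?_ (h4.atTop_div_const (by norm_num : (0 : ℝ) < 3))
        filter_upwards [ha] with n hn
        have := (log_norm_le_three_mul (h := F^[s n]) (c := x) (z := y) (r := r)
          (hF.differentiableOn_iterate ((hrb.trans inter_subset_right).trans hW) _)
          (fun z hz => hab hn (hrb hz).1) hy).2
        linarith
      refine (Real.tendsto_exp_atTop.comp h5).congr' ?_
      filter_upwards [ha] with n hn
      have hpos : 1 < ‖F^[s n] y‖ := hab hn (hrb (ball_subset_ball (by linarith) hy)).1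
      exact Real.exp_log (by linarith)
    exact (tendsto_coe_nhds_infty_iff.2 h3).congr fun n => (hF.iter_eq (hW hyW) _).symm
  · suffices ∀ᶠ y in 𝓝 x, h y ≠ OnePoint.infty from
      this.mono fun y hy => ⟨fun h => absurd h hxi, fun h => absurd h hy⟩
    obtain ⟨N, ⟨hN, hNc⟩, hNi⟩ := (closed_nhds_basis (h x)).mem_iff.1
      (isOpen_compl_singleton.mem_nhds (show h x ∈ ({OnePoint.infty}ᶜ : Set (OnePoint ℂ)) from hxi))
    obtain ⟨pa, ha, pb, hb, hab⟩ := eventually_prod_iff.1 ((hs x hx).eventually_mem hN)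
    filter_upwards [hb, hWo.mem_nhds hx] with y hy hyW
    exact hNi (hNc.mem_of_tendsto (hpt y hyW) (ha.mono fun n hn => hab hn hy))

/-- If one orbit starting in a Fatou component escapes, then the iterates tend to infinity locally
uniformly on the whole component. -/
theorem tendsto_norm_iterate_atTop (hF : Represents F f) {z w : ℂ}
    (hz : Tendsto (fun n => ‖F^[n] z‖) atTop atTop)
    (hw : w ∈ connectedComponentIn (fatouSet f) z) :
    Tendsto (fun p : ℕ × ℂ => ‖F^[p.1] p.2‖) (atTop ×ˢ 𝓝 w) atTop := by
  have hzf : z ∈ fatouSet f := connectedComponentIn_nonempty_iff.1 ⟨w, hw⟩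
  have hsub := connectedComponentIn_subset (fatouSet f) z
  -- Normality turns escape at one point of a small disc into continuous convergence at the others.
  have key : ∀ x ∈ fatouSet f, ∃ r > 0, ball x r ⊆ fatouSet f ∧ ∀ y ∈ ball x r, ∀ y' ∈ ball x r,
      Tendsto (fun n => ‖F^[n] y‖) atTop atTop →
      Tendsto (fun p : ℕ × ℂ => ‖F^[p.1] p.2‖) (atTop ×ˢ 𝓝 y') atTop := by
    intro x hx
    obtain ⟨r, hr, hrf, hdef, hnorm⟩ := exists_ball_of_mem_fatouSet hx
    refine ⟨r, hr, hrf, fun y hy y' hy' hesc => ?_⟩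
    rw [← tendsto_coe_nhds_infty_iff]
    refine tendsto_of_subseq_tendsto fun ns hns => ?_
    obtain ⟨t, ht, h, hh⟩ := hnorm fun k => (ns k).1
    rw [sphereTendsto_iff_tendsto_prod isOpen_ball fun n => hF.continuousOn_iter hrf _] at hh
    refine ⟨t, ?_⟩
    have hns1 : Tendsto (fun k => (ns (t k)).1) atTop atTop :=
      (tendsto_fst.comp hns).comp ht.tendsto_atTop
    have hns2 : Tendsto (fun k => (ns (t k)).2) atTop (𝓝 y') :=
      (tendsto_snd.comp hns).comp ht.tendsto_atTop
    have hyi : h y = OnePoint.infty := by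
      refine tendsto_nhds_unique ((hh y hy).comp (tendsto_id.prodMk tendsto_const_nhds)) ?_
      refine (tendsto_coe_nhds_infty_iff.2 (hesc.comp hns1)).congr fun n => ?_
      exact (hF.iter_eq (hrf hy) _).symm
    have hy'i := hF.limit_eq_infty (s := fun k => (ns (t k)).1) isOpen_ball
      (convex_ball x r).isPreconnected hrf hh hy hy' hyi
    have h1 := (hh y' hy').comp (tendsto_id.prodMk hns2)
    rw [hy'i] at h1
    refine h1.congr' ?_
    filter_upwards [hns2.eventually (isOpen_ball.mem_nhds hy')] with n hn
    exact hF.iter_eq (hrf hn) _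
  have hpt : ∀ {y : ℂ}, Tendsto (fun p : ℕ × ℂ => ‖F^[p.1] p.2‖) (atTop ×ˢ 𝓝 y) atTop →
      Tendsto (fun n => ‖F^[n] y‖) atTop atTop := fun h =>
    h.comp (tendsto_id.prodMk tendsto_const_nhds)
  have hwesc : Tendsto (fun n => ‖F^[n] w‖) atTop atTop := by
    refine isPreconnected_connectedComponentIn.induction₂'
      (fun x y => Tendsto (fun n => ‖F^[n] x‖) atTop atTop →
        Tendsto (fun n => ‖F^[n] y‖) atTop atTop)
      (fun x hx => ?_) (fun _ _ _ _ _ _ h1 h2 h => h2 (h1 h)) (mem_connectedComponentIn hzf) hw hz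
    obtain ⟨r, hr, -, hr'⟩ := key x (hsub hx)
    filter_upwards [nhdsWithin_le_nhds (ball_mem_nhds x hr)] with y hy
    exact ⟨fun h => hpt (hr' x (mem_ball_self hr) y hy h),
      fun h => hpt (hr' y hy x (mem_ball_self hr) h)⟩
  obtain ⟨r, hr, -, hr'⟩ := key w (hsub hw)
  exact hr' w (mem_ball_self hr) w (mem_ball_self hr) hwesc

end Represents

namespace Represents

variable {F : ℂ → ℂ} {f : ℂ → OnePoint ℂ} {l : ℤ}

theorem iterate_add_int (hF : Represents F f) (hl : HasPseudoperiod f l) {x : ℂ}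
    (hx : x ∈ fatouSet f) (n : ℕ) (k : ℤ) : F^[n] (x + k) = F^[n] x + k * l ^ n := by
  have h1 : ∀ n, iter f n (x + k) = ((F^[n] x + k * l ^ n : ℂ) : OnePoint ℂ) := by
    intro n
    rw [hl.iter_add_int, hF.iter_eq hx, OnePoint.map_some]
    push_cast
    rfl
  have h2 := (hF.iter_eq_of_ne_infty (z := x + k)
    (fun n => by rw [h1 n]; exact OnePoint.coe_ne_infty _) n).1
  rw [h1 n, OnePoint.coe_eq_coe] at h2
  exact h2.symm

/-! ### Growth of the iterates on an escaping component -/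

/-- On a small disc in an escaping Fatou component, the quantities `log ‖fᵐ‖` are comparable with
their values at the base point, uniformly in `m`: Harnack's inequality along a chain of discs. -/
theorem exists_ball_log_norm_comparable (hF : Represents F f) {z w : ℂ}
    (hz : Tendsto (fun n => ‖F^[n] z‖) atTop atTop)
    (hw : w ∈ connectedComponentIn (fatouSet f) z) :
    ∃ r > 0, ball w r ⊆ connectedComponentIn (fatouSet f) z ∧ ∃ K : ℝ, 0 < K ∧
      ∀ᶠ m in atTop, ∀ x ∈ ball w r, 1 < ‖F^[m] x‖ ∧
        Real.log ‖F^[m] x‖ ≤ K * Real.log ‖F^[m] z‖ ∧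
        Real.log ‖F^[m] z‖ ≤ K * Real.log ‖F^[m] x‖ := by
  set V := connectedComponentIn (fatouSet f) z with hV
  have hVf : V ⊆ fatouSet f := connectedComponentIn_subset _ _
  have hVo : IsOpen V := (isOpen_fatouSet f).connectedComponentIn
  have hzV : z ∈ V := mem_connectedComponentIn (connectedComponentIn_nonempty_iff.1 ⟨w, hw⟩)
  have hlocal : ∀ x ∈ V, ∃ r > 0, ball x r ⊆ V ∧ ∀ᶠ m in atTop, ∀ y ∈ ball x r,
      1 < ‖F^[m] y‖ ∧ Real.log ‖F^[m] y‖ ≤ 3 * Real.log ‖F^[m] x‖ ∧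
        Real.log ‖F^[m] x‖ ≤ 3 * Real.log ‖F^[m] y‖ := by
    intro x hx
    obtain ⟨pa, ha, pb, hb, hab⟩ := eventually_prod_iff.1
      ((hF.tendsto_norm_iterate_atTop hz hx).eventually_gt_atTop 1)
    obtain ⟨r, hr, hrb⟩ := Metric.mem_nhds_iff.1 (inter_mem hb (hVo.mem_nhds hx))
    have hrV : ball x r ⊆ V := hrb.trans inter_subset_right
    have hhalf : ball x (r / 2) ⊆ ball x r := ball_subset_ball (by linarith)
    refine ⟨r / 2, half_pos hr, hhalf.trans hrV, ha.mono fun m hm y hy => ?_⟩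
    exact ⟨hab hm (hrb (hhalf hy)).1, log_norm_le_three_mul
      (hF.differentiableOn_iterate (hrV.trans hVf) m) (fun u hu => hab hm (hrb hu).1) hy⟩
  have hchain : ∃ K : ℝ, 0 < K ∧ ∀ᶠ m in atTop,
      Real.log ‖F^[m] w‖ ≤ K * Real.log ‖F^[m] z‖ ∧
      Real.log ‖F^[m] z‖ ≤ K * Real.log ‖F^[m] w‖ := by
    refine isPreconnected_connectedComponentIn.induction₂'
      (fun x y => ∃ K : ℝ, 0 < K ∧ ∀ᶠ m in atTop,
        Real.log ‖F^[m] y‖ ≤ K * Real.log ‖F^[m] x‖ ∧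
        Real.log ‖F^[m] x‖ ≤ K * Real.log ‖F^[m] y‖) (fun x hx => ?_) ?_ hzV hw
    · obtain ⟨r, hr, -, h⟩ := hlocal x hx
      filter_upwards [nhdsWithin_le_nhds (ball_mem_nhds x hr)] with y hy
      exact ⟨⟨3, by norm_num, h.mono fun m hm => (hm y hy).2⟩,
        ⟨3, by norm_num, h.mono fun m hm => (hm y hy).2.symm⟩⟩
    · rintro x y u - - - ⟨K, hK, h⟩ ⟨K', hK', h'⟩
      refine ⟨K * K', by positivity, ?_⟩
      filter_upwards [h, h'] with m h1 h2
      constructor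
      · calc _ ≤ K' * Real.log ‖F^[m] y‖ := h2.1
          _ ≤ K' * (K * Real.log ‖F^[m] x‖) := by gcongr; exact h1.1
          _ = _ := by ring
      · calc _ ≤ K * Real.log ‖F^[m] y‖ := h1.2
          _ ≤ K * (K' * Real.log ‖F^[m] u‖) := by gcongr; exact h2.2
          _ = _ := by ring
  obtain ⟨K, hK, h⟩ := hchain
  obtain ⟨r, hr, hrV, h'⟩ := hlocal w hw
  refine ⟨r, hr, hrV, 3 * K, by positivity, ?_⟩
  filter_upwards [h, h'] with m h1 h2 x hx
  obtain ⟨h3, h4, h5⟩ := h2 x hx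
  refine ⟨h3, by nlinarith [h1.1], ?_⟩
  calc _ ≤ K * Real.log ‖F^[m] w‖ := h1.2
    _ ≤ K * (3 * Real.log ‖F^[m] x‖) := by gcongr
    _ = _ := by ring

/-- If the orbit of `z` at most squares its modulus at each step, then near every point of the
Fatou component of `z` each further iterate is bounded by a fixed power of any value of the
preceding one. -/
theorem exists_ball_norm_succ_le_pow (hF : Represents F f) {z w : ℂ}
    (hz : Tendsto (fun n => ‖F^[n] z‖) atTop atTop)
    (hgrow : ∀ᶠ m in atTop, ‖F^[m + 1] z‖ ≤ ‖F^[m] z‖ ^ 2)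
    (hw : w ∈ connectedComponentIn (fatouSet f) z) :
    ∃ r > 0, ball w r ⊆ connectedComponentIn (fatouSet f) z ∧
      (∀ M : ℝ, ∀ᶠ m in atTop, ∀ x ∈ ball w r, M < ‖F^[m] x‖) ∧
      ∃ N : ℕ, ∀ᶠ m in atTop, ∀ x ∈ ball w r, ∀ y ∈ ball w r,
        ‖F^[m + 1] x‖ ≤ ‖F^[m] y‖ ^ N := by
  obtain ⟨r, hr, hrV, K, hK, h⟩ := hF.exists_ball_log_norm_comparable hz hw
  refine ⟨r, hr, hrV, fun M => ?_, ⌈K * (2 * K)⌉₊, ?_⟩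
  · have h1 := (Real.tendsto_log_atTop.comp hz).eventually_gt_atTop (K * Real.log (max M 1))
    filter_upwards [h, h1] with m hm hm1 x hx
    obtain ⟨h2, -, h3⟩ := hm x hx
    have h4 : Real.log (max M 1) < Real.log ‖F^[m] x‖ :=
      lt_of_mul_lt_mul_left (hm1.trans_le h3) hK.le
    exact (le_max_left _ _).trans_lt
      ((Real.log_lt_log_iff (by positivity) (by linarith)).1 h4)
  · have h1 := (tendsto_add_atTop_nat 1).eventually h
    have h2 := (tendsto_add_atTop_nat 1).eventually (hz.eventually_gt_atTop 0)
    filter_upwards [h, h1, h2, hgrow] with m hm hm1 hm2 hg x hx y hy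
    obtain ⟨h3, h4, -⟩ := hm1 x hx
    obtain ⟨h5, -, h6⟩ := hm y hy
    have h7 : Real.log ‖F^[m + 1] z‖ ≤ 2 * Real.log ‖F^[m] z‖ := by
      have := Real.log_le_log hm2 hg
      rwa [Real.log_pow, Nat.cast_ofNat] at this
    have h8 : 0 < Real.log ‖F^[m] y‖ := Real.log_pos h5
    rw [← Real.log_le_log_iff (by linarith) (by positivity), Real.log_pow]
    calc Real.log ‖F^[m + 1] x‖ ≤ K * Real.log ‖F^[m + 1] z‖ := h4
      _ ≤ K * (2 * Real.log ‖F^[m] z‖) := by gcongr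
      _ ≤ K * (2 * (K * Real.log ‖F^[m] y‖)) := by gcongr
      _ = K * (2 * K) * Real.log ‖F^[m] y‖ := by ring
      _ ≤ _ := by gcongr; exact Nat.le_ceil _

/-- The logarithmic derivatives of the iterates are locally bounded in the Fatou component of `z`.
Otherwise some `fᵐ` covers, from a small disc, a large round annulus. That annulus contains a large
disc centred at an integer, on which `f` is finite and has polynomial growth. -/
theorem exists_ball_logDeriv_le (hF : Represents F f) (hf : ¬ IsRationalMap f)
    (hl : HasPseudoperiod f l) {z w : ℂ}
    (hz : Tendsto (fun n => ‖F^[n] z‖) atTop atTop)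
    (hgrow : ∀ᶠ m in atTop, ‖F^[m + 1] z‖ ≤ ‖F^[m] z‖ ^ 2)
    (hw : w ∈ connectedComponentIn (fatouSet f) z) :
    ∃ r > 0, ball w r ⊆ connectedComponentIn (fatouSet f) z ∧ ∃ A : ℝ,
      ∀ᶠ m in atTop, ∀ x ∈ ball w r, F^[m] x ≠ 0 ∧ ‖deriv (F^[m]) x / F^[m] x‖ ≤ A := by
  obtain ⟨r, hr, hrV, hlarge, N, hN⟩ := hF.exists_ball_norm_succ_le_pow hz hgrow hw
  have hrf : ball w r ⊆ fatouSet f := hrV.trans (connectedComponentIn_subset _ _)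
  refine ⟨r / 4, by positivity, (ball_subset_ball (by linarith)).trans hrV, 384 / (r / 4), ?_⟩
  by_contra hcon
  refine hf (hF.isRationalMap_of_growth hl (C := 2) (N := N) fun R₀ => ?_)
  obtain ⟨m, hbad, hm1, hm2⟩ := ((not_eventually.1 hcon).and_eventually
    ((hlarge (max R₀ 1)).and hN)).exists
  push Not at hbad
  obtain ⟨x, hx, hbad⟩ := hbad
  have hxr : ball x (r / 2) ⊆ ball w r := by
    refine ball_subset_ball' ?_
    have := mem_ball.1 hx
    linarith
  have hne : ∀ y ∈ ball w r, F^[m] y ≠ 0 := fun y hy => norm_pos_iff.1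
    ((zero_lt_one.trans_le (le_max_right R₀ 1)).trans (hm1 y hy))
  have hbig := hbad (hne x (hxr (mem_ball_self (by positivity))))
  obtain ⟨ρ, hρ, hann⟩ := exists_annulus_subset_image (h := F^[m]) (c := x) (r := r / 4)
    (r' := r / 2) (by positivity) (by linarith)
    (hF.differentiableOn_iterate (hxr.trans hrf) m) (fun y hy => hne y (hxr hy)) (by
      rw [div_lt_iff₀' (by positivity)] at hbig
      exact hbig.le)
  have hcl : closedBall x (r / 4) ⊆ ball w r :=
    (closedBall_subset_ball (by linarith)).trans hxr
  obtain ⟨y, hy, hyρ⟩ := hann (ρ : ℂ) (by simp [abs_of_pos hρ]) (by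
    rw [Complex.norm_real, Real.norm_of_nonneg hρ.le]; linarith)
  have hyn : ‖F^[m] y‖ = ρ := by rw [hyρ, Complex.norm_real, Real.norm_of_nonneg hρ.le]
  have hρbig := hm1 y (hcl hy)
  rw [hyn, max_lt_iff] at hρbig
  -- The disc of radius `3ρ` around the integer part of `5ρ` lies in the annulus `ρ ≤ ‖u‖ ≤ 9ρ`.
  have hj1 := Int.floor_le (5 * ρ)
  have hj2 := Int.lt_floor_add_one (5 * ρ)
  have hjabs : |((⌊5 * ρ⌋ : ℤ) : ℝ)| ≤ 5 * ρ := by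
    rw [abs_of_nonneg (by linarith)]; exact hj1
  refine ⟨3 * ρ, by linarith, ⌊5 * ρ⌋, by linarith, fun u hu => ?_⟩
  rw [mem_ball, dist_eq_norm] at hu
  have hjn : ‖((⌊5 * ρ⌋ : ℤ) : ℂ)‖ = ((⌊5 * ρ⌋ : ℤ) : ℝ) := by
    rw [Complex.norm_intCast, abs_of_nonneg (by linarith)]
  have hu1 := norm_sub_norm_le ((⌊5 * ρ⌋ : ℤ) : ℂ) u
  have hu2 := norm_sub_norm_le u ((⌊5 * ρ⌋ : ℤ) : ℂ)
  rw [norm_sub_rev] at hu1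
  rw [hjn] at hu1 hu2
  obtain ⟨x', hx', rfl⟩ := hann u (by linarith) (by linarith)
  refine ⟨hF.analyticAt (hF.iterate_mem_fatouSet hf (hrf (hcl hx')) m), ?_⟩
  have h1 := hm2 x' (hcl hx') y (hcl hy)
  rw [Function.iterate_succ_apply', hyn] at h1
  have h2 : ρ ^ N ≤ (3 * ρ) ^ N := by gcongr; linarith
  have h3 : 0 ≤ (3 * ρ) ^ N := by positivity
  linarith

/-- Locally in the Fatou component of `z`, the iterates are at most of the size of the orbit
of `z`. -/
theorem exists_ball_norm_le_mul (hF : Represents F f) (hf : ¬ IsRationalMap f)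
    (hl : HasPseudoperiod f l) {z w : ℂ}
    (hz : Tendsto (fun n => ‖F^[n] z‖) atTop atTop)
    (hgrow : ∀ᶠ m in atTop, ‖F^[m + 1] z‖ ≤ ‖F^[m] z‖ ^ 2)
    (hw : w ∈ connectedComponentIn (fatouSet f) z) :
    ∃ r > 0, ball w r ⊆ connectedComponentIn (fatouSet f) z ∧ ∃ K : ℝ,
      ∀ᶠ m in atTop, ∀ x ∈ ball w r, ‖F^[m] x‖ ≤ K * ‖F^[m] z‖ := by
  set V := connectedComponentIn (fatouSet f) z with hV
  have hVf : V ⊆ fatouSet f := connectedComponentIn_subset _ _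
  have hzV : z ∈ V := mem_connectedComponentIn (connectedComponentIn_nonempty_iff.1 ⟨w, hw⟩)
  have hlocal : ∀ x ∈ V, ∃ r > 0, ball x r ⊆ V ∧ ∃ K : ℝ, 0 ≤ K ∧ ∀ᶠ m in atTop,
      ∀ y ∈ ball x r, ∀ y' ∈ ball x r, ‖F^[m] y'‖ ≤ K * ‖F^[m] y‖ := by
    intro x hx
    obtain ⟨r, hr, hrV, A, hA⟩ := hF.exists_ball_logDeriv_le hf hl hz hgrow hx
    refine ⟨r, hr, hrV, Real.exp (A * (2 * r)), (Real.exp_pos _).le,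
      hA.mono fun m hm y hy y' hy' => ?_⟩
    have h1 := norm_le_exp_mul_norm_of_logDeriv_le
      (hF.differentiableOn_iterate (hrV.trans hVf) m) (fun u hu => (hm u hu).1)
      (fun u hu => (hm u hu).2) hy hy'
    have hA0 : 0 ≤ A := (norm_nonneg _).trans (hm y hy).2
    have h2 : ‖y' - y‖ ≤ 2 * r := by
      rw [← dist_eq_norm]
      have := dist_triangle_right y' y x
      rw [mem_ball] at hy hy'
      linarith
    refine h1.trans ?_
    gcongr
  have hchain : ∃ K : ℝ, 0 ≤ K ∧ ∀ᶠ m in atTop, ‖F^[m] w‖ ≤ K * ‖F^[m] z‖ := by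
    refine isPreconnected_connectedComponentIn.induction₂'
      (fun x y => ∃ K : ℝ, 0 ≤ K ∧ ∀ᶠ m in atTop, ‖F^[m] y‖ ≤ K * ‖F^[m] x‖)
      (fun x hx => ?_) ?_ hzV hw
    · obtain ⟨r, hr, -, K, hK, h⟩ := hlocal x hx
      filter_upwards [nhdsWithin_le_nhds (ball_mem_nhds x hr)] with y hy
      exact ⟨⟨K, hK, h.mono fun m hm => hm x (mem_ball_self hr) y hy⟩,
        ⟨K, hK, h.mono fun m hm => hm y hy x (mem_ball_self hr)⟩⟩
    · rintro x y u - - - ⟨K, hK, h⟩ ⟨K', hK', h'⟩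
      refine ⟨K' * K, by positivity, ?_⟩
      filter_upwards [h, h'] with m h1 h2
      calc _ ≤ K' * ‖F^[m] y‖ := h2
        _ ≤ K' * (K * ‖F^[m] x‖) := by gcongr
        _ = _ := by ring
  obtain ⟨K, hK, h⟩ := hchain
  obtain ⟨r, hr, hrV, K', hK', h'⟩ := hlocal w hw
  refine ⟨r, hr, hrV, K' * K, ?_⟩
  filter_upwards [h, h'] with m h1 h2 x hx
  calc _ ≤ K' * ‖F^[m] w‖ := h2 w (mem_ball_self hr) x hx
    _ ≤ K' * (K * ‖F^[m] z‖) := by gcongr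
    _ = _ := by ring

end Represents

/-! ### Orbits of pseudoperiodic points -/

theorem tendsto_abs_geom_sum_atTop {L : ℤ} (hL : L = 1 ∨ 2 ≤ |L|) :
    Tendsto (fun n => |((∑ i ∈ Finset.range n, L ^ i : ℤ) : ℝ)|) atTop atTop := by
  rcases hL with rfl | hL
  · simpa using tendsto_natCast_atTop_atTop
  · have hL' : (2 : ℝ) ≤ |(L : ℝ)| := by exact_mod_cast hL
    have h1 : 0 < |(L : ℝ) - 1| := by
      have := abs_sub_abs_le_abs_sub (L : ℝ) 1
      rw [abs_one] at this
      linarith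
    have h2 : Tendsto (fun n : ℕ => ((2 : ℝ) ^ n - 1) / |(L : ℝ) - 1|) atTop atTop :=
      (tendsto_atTop_add_const_right _ (-1)
        (tendsto_pow_atTop_atTop_of_one_lt one_lt_two)).atTop_div_const h1
    refine tendsto_atTop_mono (fun n => ?_) h2
    rw [div_le_iff₀ h1, ← abs_mul]
    push_cast
    rw [geom_sum_mul]
    have h3 := abs_sub_abs_le_abs_sub ((L : ℝ) ^ n) 1
    rw [abs_one, abs_pow] at h3
    have h4 : (2 : ℝ) ^ n ≤ |(L : ℝ)| ^ n := by gcongr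
    linarith

namespace Represents

variable {F : ℂ → ℂ} {f : ℂ → OnePoint ℂ} {l : ℤ}

theorem iterate_mul_eq (hF : Represents F f) (hl : HasPseudoperiod f l) {z : ℂ}
    (hz : z ∈ fatouSet f) {p : ℕ} {σ : ℤ} (hσ : F^[p] z = z + σ) (n : ℕ) :
    F^[p * n] z = z + ((σ * ∑ i ∈ Finset.range n, (l ^ p) ^ i : ℤ) : ℂ) := by
  induction n with
  | zero => simp
  | succ n ih =>
    rw [Nat.mul_succ, Function.iterate_add_apply, hσ, hF.iterate_add_int hl hz, ih,
      Finset.sum_range_succ]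
    push_cast
    ring

theorem iterate_add_mul_eq (hF : Represents F f) (hl : HasPseudoperiod f l) {z : ℂ}
    (hz : z ∈ fatouSet f) {p : ℕ} {σ : ℤ} (hσ : F^[p] z = z + σ) (j n : ℕ) :
    F^[j + p * n] z = F^[j] z + ((σ * ∑ i ∈ Finset.range n, (l ^ p) ^ i : ℤ) : ℂ) * l ^ j := by
  rw [Function.iterate_add_apply, hF.iterate_mul_eq hl hz hσ, hF.iterate_add_int hl hz]

/-- Along each residue class modulo `p`, the orbit of a pseudoperiodic point moves by integers of
unbounded modulus. -/
theorem tendsto_norm_iterate_of_pseudoperiodic (hF : Represents F f) (hl : HasPseudoperiod f l)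
    {z : ℂ} (hz : z ∈ fatouSet f) {p : ℕ} (hp : 1 ≤ p) {σ : ℤ} (hσ0 : σ ≠ 0)
    (hσ : F^[p] z = z + σ) (hlp : 2 ≤ |l| ∨ l ^ p = 1) :
    Tendsto (fun n => ‖F^[n] z‖) atTop atTop := by
  have hl0 : l ≠ 0 := by
    rintro rfl
    rcases hlp with h | h
    · norm_num at h
    · rw [zero_pow (by omega)] at h; exact zero_ne_one h
  have hL : l ^ p = 1 ∨ 2 ≤ |l ^ p| := by
    refine hlp.symm.imp_right fun h => ?_
    rw [abs_pow]
    exact h.trans (le_self_pow₀ (by linarith) (by omega))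
  have h1 : Tendsto (fun m : ℕ => m / p) atTop atTop :=
    Nat.tendsto_div_const_atTop (by omega)
  have h2 := tendsto_atTop_add_const_right _ (-∑ j ∈ Finset.range p, ‖F^[j] z‖)
    ((tendsto_abs_geom_sum_atTop hL).comp h1)
  refine tendsto_atTop_mono (fun m => ?_) h2
  simp only [Function.comp]
  set S : ℤ := ∑ i ∈ Finset.range (m / p), (l ^ p) ^ i with hS
  have h3 := hF.iterate_add_mul_eq hl hz hσ (m % p) (m / p)
  rw [Nat.mod_add_div, ← hS] at h3
  have h4 : ‖F^[m % p] z‖ ≤ ∑ j ∈ Finset.range p, ‖F^[j] z‖ :=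
    Finset.single_le_sum (f := fun j => ‖F^[j] z‖) (fun _ _ => norm_nonneg _)
      (Finset.mem_range.2 (Nat.mod_lt _ (by omega)))
  have h5 : |(S : ℝ)| ≤ ‖((σ * S : ℤ) : ℂ) * (l : ℂ) ^ (m % p)‖ := by
    have h6 : ((σ * S : ℤ) : ℂ) * (l : ℂ) ^ (m % p) = ((S * (σ * l ^ (m % p)) : ℤ) : ℂ) := by
      push_cast; ring
    rw [h6, Complex.norm_intCast, Int.cast_mul, abs_mul]
    refine le_mul_of_one_le_right (abs_nonneg _) ?_
    exact_mod_cast Int.one_le_abs (mul_ne_zero hσ0 (pow_ne_zero _ hl0))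
  have h7 := norm_sub_le (F^[m] z) (F^[m % p] z)
  rw [h3, add_sub_cancel_left, ← h3] at h7
  linarith

/-- The orbit of a pseudoperiodic point stays within finitely many integer-translation classes, on
each of which `f` is affine with factor `ℓ`; so `‖fᵐ⁺¹(z)‖ ≤ |ℓ| ‖fᵐ(z)‖ + B` for a constant `B`. -/
theorem eventually_norm_iterate_succ_le_sq (hF : Represents F f) (hl : HasPseudoperiod f l)
    {z : ℂ} (hz : z ∈ fatouSet f) {p : ℕ} (hp : 1 ≤ p) {σ : ℤ} (hσ : F^[p] z = z + σ)
    (hesc : Tendsto (fun n => ‖F^[n] z‖) atTop atTop) :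
    ∀ᶠ m in atTop, ‖F^[m + 1] z‖ ≤ ‖F^[m] z‖ ^ 2 := by
  set B : ℝ := ∑ j ∈ Finset.range p, (‖F^[j + 1] z‖ + |(l : ℝ)| * ‖F^[j] z‖) with hB
  have hB0 : 0 ≤ B := Finset.sum_nonneg fun _ _ => by positivity
  filter_upwards [hesc.eventually_ge_atTop (|(l : ℝ)| + B + 1)] with m hm
  set S : ℤ := σ * ∑ i ∈ Finset.range (m / p), (l ^ p) ^ i with hS
  have h3 := hF.iterate_add_mul_eq hl hz hσ (m % p) (m / p)
  have h4 := hF.iterate_add_mul_eq hl hz hσ (m % p + 1) (m / p)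
  rw [Nat.add_right_comm, Nat.mod_add_div, ← hS] at h4
  rw [Nat.mod_add_div, ← hS] at h3
  have h5 : F^[m + 1] z = l * F^[m] z + (F^[m % p + 1] z - l * F^[m % p] z) := by
    rw [h4, h3]; ring
  have h6 : ‖F^[m % p + 1] z‖ + |(l : ℝ)| * ‖F^[m % p] z‖ ≤ B :=
    Finset.single_le_sum (f := fun j => ‖F^[j + 1] z‖ + |(l : ℝ)| * ‖F^[j] z‖)
      (fun _ _ => by positivity) (Finset.mem_range.2 (Nat.mod_lt _ (by omega)))
  have h7 : ‖F^[m + 1] z‖ ≤ |(l : ℝ)| * ‖F^[m] z‖ + B := by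
    rw [h5]
    refine (norm_add_le _ _).trans (add_le_add (by rw [norm_mul, Complex.norm_intCast])
      ((norm_sub_le _ _).trans ?_))
    rwa [norm_mul, Complex.norm_intCast]
  have h8 : 0 ≤ |(l : ℝ)| := abs_nonneg _
  nlinarith

/-! ### Components containing integer translates of a point -/

/-- For `|ℓ| ≥ 2`, a Fatou component containing a pseudoperiodic point `z` contains no other integer
translate of `z`. If it contained `z + q`, the functions `fᵖⁿ / fᵖⁿ(z)` would have a limit taking
the value `1` at `z` but not at `z + q`; being open at `z`, this limit shows that `fᵖⁿ` maps a small
disc over a disc around `fᵖⁿ(z) ∈ z + ℤ` of radius proportional to `‖fᵖⁿ(z)‖`, on which `f` is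
finite and has polynomial growth. -/
theorem add_int_notMem_component (hF : Represents F f) (hf : ¬ IsRationalMap f)
    (hl : HasPseudoperiod f l) (hl2 : 2 ≤ |l|) {z : ℂ} (hz : z ∈ fatouSet f) {p : ℕ} (hp : 1 ≤ p)
    {σ q : ℤ} (hσ0 : σ ≠ 0) (hσ : F^[p] z = z + σ) (hq : q ≠ 0) :
    z + q ∉ connectedComponentIn (fatouSet f) z := by
  intro hzq
  set V := connectedComponentIn (fatouSet f) z with hV
  have hVf : V ⊆ fatouSet f := connectedComponentIn_subset _ _
  have hVo : IsOpen V := (isOpen_fatouSet f).connectedComponentIn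
  have hzV : z ∈ V := mem_connectedComponentIn hz
  have hesc := hF.tendsto_norm_iterate_of_pseudoperiodic hl hz hp hσ0 hσ (Or.inl hl2)
  have hgrow := hF.eventually_norm_iterate_succ_le_sq hl hz hp hσ hesc
  -- An ultrafilter takes the place of the passage to subsequences.
  set 𝒰 : Ultrafilter ℕ := hyperfilter ℕ
  have hU : (𝒰 : Filter ℕ) ≤ atTop := Nat.hyperfilter_le_atTop
  have hpn : Tendsto (fun n : ℕ => p * n) 𝒰 atTop :=
    (tendsto_id.const_mul_atTop' (by omega)).mono_left hU
  set E : ℕ → ℂ → ℂ := fun n x => F^[p * n] x / F^[p * n] z with hE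
  have hEd : ∀ n, DifferentiableOn ℂ (E n) V := fun n =>
    (hF.differentiableOn_iterate hVf _).div_const _
  obtain ⟨G, hG⟩ := exists_tendstoLocallyUniformlyOn_of_locally_bounded 𝒰 (E := E) (V := V) (by
    intro w hw
    obtain ⟨r, hr, hrV, K, hK⟩ := hF.exists_ball_norm_le_mul hf hl hesc hgrow hw
    refine ⟨r, hr, K, ?_⟩
    filter_upwards [hpn.eventually hK, hpn.eventually (hesc.eventually_gt_atTop 0)] with n h1 h2
    refine ⟨(hEd n).mono hrV, fun x hx => ?_⟩
    rw [hE]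
    simp only
    rw [norm_div, div_le_iff₀ h2]
    exact h1 x hx)
  have hGd : DifferentiableOn ℂ G V := hG.differentiableOn (Eventually.of_forall hEd) hVo
  have hEz : ∀ᶠ n in (𝒰 : Filter ℕ), E n z = 1 := by
    filter_upwards [hpn.eventually (hesc.eventually_gt_atTop 0)] with n h2
    exact div_self (norm_pos_iff.1 h2)
  have hGz : G z = 1 := tendsto_nhds_unique (hG.tendsto_at hzV)
    (tendsto_const_nhds.congr' (hEz.mono fun n hn => hn.symm))
  have hGzq : G (z + q) ≠ 1 := by
    -- `‖fᵖⁿ(z + q) - fᵖⁿ(z)‖ = |q| |ℓ|ᵖⁿ` is comparable with `‖fᵖⁿ(z)‖ ≤ C |ℓ|ᵖⁿ`.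
    set C : ℝ := ‖z‖ + 2 * |(σ : ℝ)| with hC
    have hσ1 : (1 : ℝ) ≤ |(σ : ℝ)| := by exact_mod_cast Int.one_le_abs hσ0
    have hq1 : (1 : ℝ) ≤ |(q : ℝ)| := by exact_mod_cast Int.one_le_abs hq
    have hC0 : 0 < C := by positivity
    have hlim : Tendsto (fun n => ‖E n (z + q) - 1‖) 𝒰 (𝓝 ‖G (z + q) - 1‖) :=
      ((hG.tendsto_at hzq).sub_const 1).norm
    have hge : 1 / C ≤ ‖G (z + q) - 1‖ := by
      refine ge_of_tendsto hlim ?_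
      filter_upwards [hpn.eventually (hesc.eventually_gt_atTop 0)] with n h2
      set S : ℤ := ∑ i ∈ Finset.range n, (l ^ p) ^ i with hS
      have h3 : E n (z + q) - 1 = q * l ^ (p * n) / F^[p * n] z := by
        have := norm_pos_iff.1 h2
        rw [hE]
        simp only
        rw [hF.iterate_add_int hl hz]
        field_simp
        ring
      have hl2' : (2 : ℝ) ≤ |(l : ℝ)| := by exact_mod_cast hl2
      have hLp : (2 : ℝ) ≤ |(l : ℝ) ^ p| := by
        rw [abs_pow]
        exact hl2'.trans (le_self_pow₀ (by linarith) (by omega))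
      have hpow : 1 ≤ |(l : ℝ)| ^ (p * n) := one_le_pow₀ (by linarith)
      have h4 : |(S : ℝ)| ≤ 2 * |(l : ℝ)| ^ (p * n) := by
        have h5 : (S : ℝ) * ((l : ℝ) ^ p - 1) = ((l : ℝ) ^ p) ^ n - 1 := by
          rw [hS]; push_cast; rw [geom_sum_mul]
        have h6 := congrArg abs h5
        rw [abs_mul] at h6
        have h7 : 1 ≤ |(l : ℝ) ^ p - 1| := by
          have := abs_sub_abs_le_abs_sub ((l : ℝ) ^ p) 1
          rw [abs_one] at this
          linarith
        have h8 := abs_sub (((l : ℝ) ^ p) ^ n) 1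
        rw [abs_one, ← pow_mul, abs_pow, pow_mul] at h8
        rw [← pow_mul] at h8 h6
        calc |(S : ℝ)| ≤ |(S : ℝ)| * |(l : ℝ) ^ p - 1| :=
              le_mul_of_one_le_right (abs_nonneg _) h7
          _ ≤ |(l : ℝ)| ^ (p * n) + 1 := by rw [h6]; exact h8
          _ ≤ _ := by linarith
      have h9 : ‖F^[p * n] z‖ ≤ C * |(l : ℝ)| ^ (p * n) := by
        rw [hF.iterate_mul_eq hl hz hσ]
        refine (norm_add_le _ _).trans ?_
        rw [Complex.norm_intCast, Int.cast_mul, abs_mul, ← hS]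
        have h10 := mul_le_mul_of_nonneg_left h4 (abs_nonneg (σ : ℝ))
        have h11 := mul_le_mul_of_nonneg_left hpow (norm_nonneg z)
        rw [hC]
        linarith
      rw [h3, norm_div, norm_mul, norm_pow, Complex.norm_intCast, Complex.norm_intCast,
        div_le_div_iff₀ hC0 h2, one_mul]
      calc ‖F^[p * n] z‖ ≤ C * |(l : ℝ)| ^ (p * n) := h9
        _ ≤ |(q : ℝ)| * (C * |(l : ℝ)| ^ (p * n)) :=
            le_mul_of_one_le_left (by positivity) hq1
        _ = _ := by ring
    intro h
    rw [h, sub_self, norm_zero] at hge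
    have := one_div_pos.2 hC0
    linarith
  -- The value `1` is isolated at `z`, so `G` keeps a distance from it on a small circle.
  have hiso : ∀ᶠ x in 𝓝[≠] z, G x ≠ 1 := by
    by_contra hcon
    rw [not_eventually] at hcon
    refine hGzq ((hGd.analyticOnNhd hVo).eqOn_of_preconnected_of_frequently_eq
      (g := fun _ => 1) analyticOnNhd_const isPreconnected_connectedComponentIn hzV
      (hcon.mono fun x hx => not_not.1 hx) hzq)
  obtain ⟨r, hr, hrV, hlarge, N, hN⟩ := hF.exists_ball_norm_succ_le_pow hesc hgrow hzV
  rw [eventually_nhdsWithin_iff] at hiso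
  obtain ⟨s', hs', hsub⟩ := Metric.mem_nhds_iff.1 (inter_mem hiso (ball_mem_nhds z hr))
  set s := s' / 2 with hs
  have hs0 : 0 < s := by positivity
  have hcl' : closedBall z s ⊆ ball z s' := closedBall_subset_ball (by linarith)
  have hcl : closedBall z s ⊆ ball z r := (hcl'.trans hsub).trans inter_subset_right
  have hspV : sphere z s ⊆ V := (sphere_subset_closedBall.trans hcl).trans hrV
  obtain ⟨x₀, hx₀, hmin⟩ := (isCompact_sphere z s).exists_isMinOn
    (NormedSpace.sphere_nonempty.2 hs0.le)
    ((hGd.continuousOn.mono hspV).sub (continuousOn_const (c := (1 : ℂ)))).norm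
  set ε := ‖G x₀ - 1‖ with hε
  have hε0 : 0 < ε := by
    rw [hε, norm_pos_iff, sub_ne_zero]
    exact (hsub (hcl' (sphere_subset_closedBall hx₀))).1 (ne_of_mem_sphere hx₀ hs0.ne')
  have hunif : TendstoUniformlyOn E G 𝒰 (sphere z s) :=
    (tendstoLocallyUniformlyOn_iff_forall_isCompact hVo).1 hG _ hspV (isCompact_sphere z s)
  have hcover : ∀ᶠ n in (𝒰 : Filter ℕ), ball 1 (ε / 2 / 2) ⊆ E n '' closedBall z s := by
    filter_upwards [Metric.tendstoUniformlyOn_iff.1 hunif (ε / 2) (by positivity), hEz]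
      with n h1 h2
    have h3 : ∀ x ∈ sphere z s, ε / 2 ≤ ‖E n x - E n z‖ := by
      intro x hx
      have h4 := h1 x hx
      have h5 : ε ≤ ‖G x - 1‖ := hmin hx
      have h6 := norm_sub_le_norm_sub_add_norm_sub (G x) (E n x) 1
      rw [dist_eq_norm] at h4
      rw [h2]
      linarith
    have h7 := DiffContOnCl.ball_subset_image_closedBall
      (DifferentiableOn.diffContOnCl_ball (hEd n) (hcl.trans hrV)) hs0 h3 (by
        intro hcon
        have hcon' : ∀ᶠ x in 𝓝 z, E n x = E n z := hcon.mono fun x hx => not_not.1 hx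
        have h8 := ((hEd n).analyticOnNhd hVo).eqOn_of_preconnected_of_eventuallyEq
          (g := fun _ => E n z) analyticOnNhd_const isPreconnected_connectedComponentIn hzV hcon'
        have h9 := h3 x₀ hx₀
        rw [h8 (hspV hx₀), sub_self, norm_zero] at h9
        linarith)
    rwa [h2] at h7
  refine hf (hF.isRationalMap_of_growth hl (C := 8 / ε + 1 + (8 / ε) ^ N) (N := N) fun R₀ => ?_)
  obtain ⟨n, h1, h2, h3, h4⟩ := (hcover.and ((hpn.eventually (hesc.eventually_ge_atTop
    (8 / ε * max R₀ ‖z‖))).and ((hpn.eventually hN).and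
      (hpn.eventually (hesc.eventually_gt_atTop 0))))).exists
  set R := ε / 8 * ‖F^[p * n] z‖ with hR
  have hR0 : 0 < R := by positivity
  have hFR : ‖F^[p * n] z‖ = 8 / ε * R := by rw [hR]; field_simp
  have hRmax : max R₀ ‖z‖ ≤ R := by
    rw [hFR] at h2
    exact le_of_mul_le_mul_left h2 (by positivity)
  have hzn := hF.iterate_mul_eq hl hz hσ n
  set j : ℤ := σ * ∑ i ∈ Finset.range n, (l ^ p) ^ i with hj
  have hzR : ‖z‖ ≤ R := (le_max_right _ _).trans hRmax
  have hC1 : 0 ≤ (8 / ε) ^ N := by positivity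
  have hC2 : 0 ≤ 8 / ε := by positivity
  refine ⟨R, (le_max_left _ _).trans hRmax, j, ?_, fun u hu => ?_⟩
  · have h5 : (j : ℂ) = F^[p * n] z - z := by rw [hzn]; ring
    rw [← Complex.norm_intCast, h5]
    refine (norm_sub_le _ _).trans ?_
    rw [hFR]
    nlinarith
  · have h5 : u / F^[p * n] z ∈ ball (1 : ℂ) (ε / 2 / 2) := by
      have hne := norm_pos_iff.1 h4
      rw [mem_ball, dist_eq_norm] at hu ⊢
      have h6 : u / F^[p * n] z - 1 = (u - F^[p * n] z) / F^[p * n] z := by field_simp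
      rw [h6, norm_div, div_lt_iff₀ h4]
      have h7 : u - F^[p * n] z = (u - j) - z := by rw [hzn]; ring
      rw [h7, hFR]
      refine (norm_sub_le _ _).trans_lt ?_
      have h8 : ε / 2 / 2 * (8 / ε * R) = R + R := by field_simp; ring
      rw [h8]
      linarith
    obtain ⟨x, hx, hxu⟩ := h1 h5
    have hxu' : F^[p * n] x = u := (div_left_inj' (norm_pos_iff.1 h4)).1 hxu
    have hxf : x ∈ fatouSet f := hVf (hrV (hcl hx))
    refine ⟨hxu' ▸ hF.analyticAt (hF.iterate_mem_fatouSet hf hxf _), ?_⟩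
    have h9 := h3 x (hcl hx) z (mem_ball_self hr)
    rw [Function.iterate_succ_apply', hxu', hFR, mul_pow] at h9
    have h10 : 0 ≤ R ^ N := by positivity
    nlinarith

end Represents

/-! ### Distinctness of the components -/

/-- If two components along the orbit of `z` coincide, then the sequence of components is eventually
periodic, so some component contains two points of the orbit of `z` under `Fᵖ`. -/
theorem exists_iterate_mem_component {F : ℂ → ℂ} {S : Set ℂ} (hG : ContinuousOn F S)
    (hFS : MapsTo F S S) {z : ℂ} {n d p : ℕ} (hp : 1 ≤ p)
    (h : F^[n + d] z ∈ connectedComponentIn S (F^[n] z)) :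
    F^[p * (n + d)] z ∈ connectedComponentIn S (F^[p * n] z) := by
  have hstep : ∀ i, n ≤ i → F^[i + d] z ∈ connectedComponentIn S (F^[i] z) := by
    intro i hi
    induction i, hi using Nat.le_induction with
    | base => exact h
    | succ i hi ih =>
      rw [Nat.add_right_comm, Function.iterate_succ_apply', Function.iterate_succ_apply']
      exact mem_connectedComponentIn_of_mapsTo hG hFS ih
  have hmul : ∀ (k i : ℕ), n ≤ i → F^[i + k * d] z ∈ connectedComponentIn S (F^[i] z) := by
    intro k i hi
    induction k with
    | zero =>
      rw [zero_mul, add_zero]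
      exact mem_connectedComponentIn (connectedComponentIn_nonempty_iff.1 ⟨_, hstep i hi⟩)
    | succ k ih =>
      rw [connectedComponentIn_eq ih, add_mul, one_mul, ← add_assoc]
      exact hstep _ (hi.trans (Nat.le_add_right _ _))
  rw [mul_add]
  exact hmul p _ (Nat.le_mul_of_pos_left n hp)

theorem geom_sum_int_ne_zero {L : ℤ} (hL : L = 1 ∨ 2 ≤ |L|) {d : ℕ} (hd : d ≠ 0) :
    ∑ i ∈ Finset.range d, L ^ i ≠ 0 := by
  rcases hL with rfl | hL
  · simpa using hd
  · intro h
    have h1 := geom_sum_mul L d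
    rw [h, zero_mul] at h1
    have h2 : |L ^ d| = 1 := by rw [sub_eq_zero.1 h1.symm, abs_one]
    rw [abs_pow] at h2
    have h3 : |L| ≤ |L| ^ d := le_self_pow₀ (by linarith) hd
    linarith

theorem mainTheorem6 (f : ℂ → OnePoint ℂ) (hf : IsProjectable f)
    (l : ℤ) (hl : HasPseudoperiod f l)
    (p : ℕ) (σ : ℤ) (hσ : σ ≠ 0) (z : ℂ) (hz : IsPseudoperiodic f p σ z)
    (U : Set ℂ) (hU : IsFatouComponent f U) (hzU : z ∈ U)
    (hfill : (0 : ℂ) ∉ fill (expOne '' U))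
    (hlp : 2 ≤ |l| ∨ l ^ p = 1) :
    IsEscapingWanderingDomain f U := by
  obtain ⟨⟨⟨F, hnf, hcoe, hinf⟩, hrat⟩, -⟩ := hf
  have hF : Represents F f := ⟨hnf, hcoe, hinf⟩
  obtain ⟨⟨hp, -, hzσ⟩, -⟩ := hz
  have hUz : U = connectedComponentIn (fatouSet f) z := by
    obtain ⟨z₀, -, rfl⟩ := hU
    exact connectedComponentIn_eq hzU
  have hUf : U ⊆ fatouSet f := hUz ▸ connectedComponentIn_subset _ _
  have hUo : IsOpen U := hUz ▸ (isOpen_fatouSet f).connectedComponentIn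
  have hUc : IsPreconnected U := hUz ▸ isPreconnected_connectedComponentIn
  have hzf : z ∈ fatouSet f := hUf hzU
  have hFσ : F^[p] z = z + σ := by
    rw [hF.iter_eq hzf, OnePoint.coe_eq_coe] at hzσ
    exact hzσ
  have hFc : ContinuousOn F (fatouSet f) := fun x hx =>
    (hF.analyticAt hx).continuousAt.continuousWithinAt
  have hFm := hF.mapsTo_fatouSet hrat
  have hLp : l ^ p = 1 ∨ 2 ≤ |l ^ p| := by
    refine hlp.symm.imp_right fun h => ?_
    rw [abs_pow]
    exact h.trans (le_self_pow₀ (by linarith) (by omega))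
  -- No two of the components along the orbit of `z` coincide.
  have hdisj : ∀ n d, d ≠ 0 →
      F^[n + d] z ∉ connectedComponentIn (fatouSet f) (F^[n] z) := by
    intro n d hd hmem
    have h1 := exists_iterate_mem_component hFc hFm hp hmem
    set a : ℤ := σ * ∑ i ∈ Finset.range n, (l ^ p) ^ i with ha
    set q : ℤ := σ * ((l ^ p) ^ n * ∑ i ∈ Finset.range d, (l ^ p) ^ i) with hq
    have hLne : l ^ p ≠ 0 := by
      rcases hLp with h | h
      · rw [h]; exact one_ne_zero
      · intro h0; rw [h0] at h; norm_num at h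
    have hq0 : q ≠ 0 := mul_ne_zero hσ
      (mul_ne_zero (pow_ne_zero _ hLne) (geom_sum_int_ne_zero hLp hd))
    have haq : F^[p * n] z = z + a := hF.iterate_mul_eq hl hzf hFσ n
    have haq' : F^[p * (n + d)] z = F^[p * n] z + q := by
      rw [hF.iterate_mul_eq hl hzf hFσ, haq, add_assoc, ← Int.cast_add]
      congr 2
      rw [ha, hq, Finset.sum_range_add, ← mul_add, Finset.mul_sum]
      simp only [pow_add]
    rw [haq'] at h1
    rcases hlp with hl2 | hl1
    · refine hF.add_int_notMem_component hrat hl hl2 (hF.iterate_mem_fatouSet hrat hzf (p * n)) hp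
        (σ := σ * l ^ (p * n)) (mul_ne_zero hσ (pow_ne_zero _ ?_)) ?_ hq0 h1
      · rintro rfl; norm_num at hl2
      · rw [← Function.iterate_add_apply, add_comm, Function.iterate_add_apply, hFσ,
          hF.iterate_add_int hl hzf]
        push_cast
        ring
    · have hl1' : l = 1 ∨ l = -1 := Int.isUnit_iff.1 (IsUnit.of_pow_eq_one hl1 (by omega))
      have hshift := mem_connectedComponentIn_of_mapsTo (G := fun x => x + ((-a : ℤ) : ℂ))
        (by fun_prop) (fun x hx => hF.add_int_mem_fatouSet hl hl1' hx (-a)) h1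
      have h2 : F^[p * n] z + ((-a : ℤ) : ℂ) = z := by rw [haq]; push_cast; ring
      have h3 : F^[p * n] z + q + ((-a : ℤ) : ℂ) = z + q := by rw [haq]; push_cast; ring
      rw [h2, h3, ← hUz] at hshift
      exact hfill (zero_mem_fill_of_add_int_mem hUo hUc hq0 hzU hshift)
  have hesc := hF.tendsto_norm_iterate_of_pseudoperiodic hl hzf hp hσ hFσ hlp
  -- The whole sequence of iterates tends to infinity locally uniformly on the component.
  have hconv : ∀ w ∈ U, Tendsto (fun p : ℕ × ℂ => iter f p.1 p.2) (atTop ×ˢ 𝓝 w)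
      (𝓝 OnePoint.infty) := by
    intro w hw
    have h1 := hF.tendsto_norm_iterate_atTop hesc (hUz ▸ hw)
    rw [← tendsto_coe_nhds_infty_iff] at h1
    refine h1.congr' ?_
    filter_upwards [tendsto_snd.eventually (hUo.mem_nhds hw)] with p hp
    exact (hF.iter_eq (hUf hp) _).symm
  refine ⟨⟨hU, fun n => connectedComponentIn (fatouSet f) (F^[n] z),
    fun n => ⟨⟨_, hF.iterate_mem_fatouSet hrat hzf n, rfl⟩, ?_⟩, ?_⟩, fun h => ⟨?_, fun h => ?_⟩⟩
  · rintro _ ⟨w, hw, rfl⟩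
    refine ⟨F^[n] w, mem_connectedComponentIn_of_mapsTo
      (hF.differentiableOn_iterate subset_rfl n).continuousOn (hFm.iterate n) (hUz ▸ hw),
      (hF.iter_eq (hUf hw) n).symm⟩
  · have hlt : ∀ n m, n < m → connectedComponentIn (fatouSet f) (F^[n] z) ≠
        connectedComponentIn (fatouSet f) (F^[m] z) := by
      intro n m hnm heq
      obtain ⟨d, rfl⟩ := Nat.exists_eq_add_of_lt hnm
      refine hdisj n (d + 1) (Nat.succ_ne_zero d) ?_
      rw [heq]
      exact mem_connectedComponentIn (hF.iterate_mem_fatouSet hrat hzf _)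
    intro n m hnm
    rcases hnm.lt_or_gt with h | h
    · exact hlt n m h
    · exact (hlt m n h).symm
  · rintro ⟨s, hs, hlim⟩ w hw
    rw [sphereTendsto_iff_tendsto_prod hUo fun n => hF.continuousOn_iter hUf _] at hlim
    exact tendsto_nhds_unique ((hlim w hw).comp (tendsto_id.prodMk tendsto_const_nhds))
      ((hconv w hw).comp (hs.tendsto_atTop.prodMk tendsto_const_nhds))
  · refine ⟨id, strictMono_id, (sphereTendsto_iff_tendsto_prod hUo
      fun n => hF.continuousOn_iter hUf _).2 fun w hw => ?_⟩
    rw [h w hw]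
    exact hconv w hw
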